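/- \textbf{Setting.} For each $n\ge 1$ let $p=p_n\ge 3$, with $p_n\to\infty$ as $n\to\infty$. Let $G_\sigma=(\{1,\dots,p\},E_\sigma)$ be a $p$-cycle whose vertices are labelled by a reverse Cuthill–McKee (RCM) ordering $\sigma$, that is, $E_\sigma$ consists of the $p$ edges $(2,1)$, $(j,j-2)$ for $3\le j\le p$, and $(p,p-1)$. Let $E_\sigma^D\supseteq E_\sigma$ be the edge set of the filled graph, obtained from $E_\sigma$ by joining, for $k=1,2,\dots$ in turn, all neighbours $j>k$ of $k$ to each other. Let $\bar\Omega=\bar\Omega_n$ be a $p\times p$ positive definite matrix with $\bar\Omega_{ij}=0$ whenever $i\ne j$ and $(i,j)\notin E_\sigma$, and let $\bar L=\bar L_n$ be its Cholesky factor (lower triangular with positive diagonal entries, $\bar\Omega=\bar L\bar L^T$). Let $Y_{n,1},\dots,Y_{n,n}$ be i.i.d. random vectors in $\mathbb R^p$ with mean $0$ and covariance matrix $\bar\Omega^{-1}$, let $\bar P$ be the underlying probability measure, and let $S=\frac1n\sum_{i=1}^n Y_{n,i}Y_{n,i}^T$. \textbf{CCA estimators.} For $1\le j\le p$ let $N_j=\{k>j:(k,j)\in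 E_\sigma^D\}$, $S^{>j}=(S_{kl})_{k,l\in N_j}$, $S^>_{\cdot j}=(S_{kj})_{k\in N_j}$ and $s_j=S_{jj}-(S^>_{\cdot j})^T(S^{>j})^{-1}S^>_{\cdot j}$. Define the lower triangular matrix $\hat L^D$ by $\hat L^D_{jj}=s_j^{-1/2}$, $(\hat L^D_{kj})_{k\in N_j}=-s_j^{-1/2}(S^{>j})^{-1}S^>_{\cdot j}$, all other entries being $0$. The matrix $\hat L$ is obtained from $\hat L^D$ by going through the entries below the diagonal row by row, from left to right in each row, and setting $\hat L_{ij}=-\hat L_{jj}^{-1}\sum_{k<j}\hat L_{ik}\hat L_{jk}$ whenever $j<i$ and $(i,j)\notin E_\sigma$; the other entries are not changed. Put $\hat\Omega=\hat L\hat L^T$. (The estimators may be given arbitrary values where the inverses or square roots do not exist.) \textbf{Lemma.} Assume: (A1) there is $\delta>0$, not depending on $n$, such that all eigenvalues of $\bar\Omega_n$ lie in $[\delta,\delta^{-1}]$; (A2) there is $c>0$, not depending on $n$, such that $E[e^{x^TY_{n,i}}]\le e^{c\,x^Tx}$ for all $n$, all $1\le i\le n$ and all $x\in\mathbb R^{p_n}$;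 (A3$'$) there is $\xi<1$, not depending on $n$, such that $|\bar L_{j,j-2}|/\bar L_{jj}\le\xi$ for all $n$ and all $3\le j\le p_n-1$; and $|E_\sigma|\log p_n/n\to0$ as $n\to\infty$. Then there exist constants $\tilde K$ and $\tilde K'$, not depending on $n$, such that $$\bar P\left(\left\{\|\hat L-\bar L\|_F\le\tilde K\sqrt{\frac{(|E_\sigma|+1)\log p_n}{n}}\right\}\cap\left\{\|\hat\Omega-\bar\Omega\|_F\le\tilde K'\sqrt{\frac{(|E_\sigma|+1)\log p_n}{n}}\right\}\right)\longrightarrow1\quad\text{as }n\to\infty,$$ where $\|\cdot\|_F$ denotes the Frobenius norm. -/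

import Mathlib

open Filter Topology MeasureTheory ProbabilityTheory Matrix
open scoped Matrix.Norms.Frobenius

/-! ### Ordered graphs and the reverse Cuthill-McKee ordering

The vertices `1, …, p` of an ordered graph are the elements `0, …, p - 1` of `Fin p`. -/

/-- The ordered graph `G_σ`: the graph on the labels, `σ u` and `σ v` being adjacent if and only
if `u` and `v` are adjacent in `G`. -/
def orderedGraph {V : Type*} {p : ℕ} (G : SimpleGraph V) (σ : V ≃ Fin p) :
    SimpleGraph (Fin p) :=
  G.map σ.toEmbedding

/-- In an ordered graph, `w` is the parent of `v` if it is the first neighbour of `v` and comes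
before `v`. -/
def IsParent {p : ℕ} (G : SimpleGraph (Fin p)) (w v : Fin p) : Prop :=
  w < v ∧ G.Adj w v ∧ ∀ x, G.Adj x v → w ≤ x

/-- `τ` lists the vertices of the (connected) graph `G` in an order produced by the
Cuthill-McKee algorithm: list a starting vertex; then run through the list and append, for each
vertex in turn, those of its neighbours that are not yet listed, by increasing degree. Thus a
vertex is appended when its first neighbour in the list is processed. The choice of
the starting vertex and ties between degrees are left open. -/
structure IsCuthillMcKeeOrdering {V : Type*} {p : ℕ} (G : SimpleGraph V) (τ : V ≃ Fin p) :
    Prop where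
  exists_parent : ∀ v : Fin p, 0 < (v : ℕ) → ∃ w, IsParent (orderedGraph G τ) w v
  queue : ∀ u v wu wv : Fin p, u < v → IsParent (orderedGraph G τ) wu u →
    IsParent (orderedGraph G τ) wv v → wu ≤ wv
  degree : ∀ u v w : Fin p, u < v → IsParent (orderedGraph G τ) w u →
    IsParent (orderedGraph G τ) w v →
    ((orderedGraph G τ).neighborSet u).ncard ≤ ((orderedGraph G τ).neighborSet v).ncard

/-- `σ` is a reverse Cuthill-McKee (RCM) ordering of `G`: reversed, it is a Cuthill-McKee
ordering. -/
def IsRCMOrdering {V : Type*} {p : ℕ} (G : SimpleGraph V) (σ : V ≃ Fin p) : Prop :=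
  IsCuthillMcKeeOrdering G (σ.trans Fin.revPerm)

/-- The edges of the filled graph: starting with the edges of `G`, the later neighbours of each
vertex `k` are joined to each other. -/
inductive FillAdj {p : ℕ} (G : SimpleGraph (Fin p)) : Fin p → Fin p → Prop
  | base {i j : Fin p} : G.Adj i j → FillAdj G i j
  | fill {k i j : Fin p} : k < i → k < j → i ≠ j → FillAdj G i k → FillAdj G j k →
      FillAdj G i j

/-- The filled graph `G_σ^D` of an ordered graph `G_σ`. -/
def filledGraph {p : ℕ} (G : SimpleGraph (Fin p)) : SimpleGraph (Fin p) where
  Adj := FillAdj G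
  symm := ⟨by
    intro i j h
    cases h with
    | base h => exact FillAdj.base h.symm
    | fill hi hj hij h₁ h₂ => exact FillAdj.fill hj hi hij.symm h₂ h₁⟩
  loopless := ⟨by
    intro i h
    cases h with
    | base h => exact G.loopless.irrefl i h
    | fill hi hj hij h₁ h₂ => exact hij rfl⟩

/-! ### Concentration matrices and Cholesky factors -/

/-- The set `ℙ_{G_σ}` of positive definite matrices whose off-diagonal entries vanish outside the
edges of the ordered graph. -/
def concentrationSet {p : ℕ} (G : SimpleGraph (Fin p)) : Set (Matrix (Fin p) (Fin p) ℝ) :=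
  {A | A.PosDef ∧ ∀ i j, i ≠ j → ¬ G.Adj i j → A i j = 0}

/-- `L` is the Cholesky factor of `A`: it is lower triangular with positive diagonal entries, and
`A = L Lᵀ`. -/
structure IsCholeskyFactor {p : ℕ} (L A : Matrix (Fin p) (Fin p) ℝ) : Prop where
  lower : ∀ i j, i < j → L i j = 0
  diag_pos : ∀ i, 0 < L i i
  eq : A = L * Lᵀ

/-! ### The CCA estimators -/

/-- The sample covariance matrix `S = (1/n) ∑ᵢ Yᵢ Yᵢᵀ` of `n` observations with known
mean `0`. -/
noncomputable def sampleCov {n p : ℕ} (y : Fin n → Fin p → ℝ) : Matrix (Fin p) (Fin p) ℝ :=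
  fun a b => (∑ i, y i a * y i b) / n

/-- The index set `{k : k > j, (k,j) an edge}`. -/
abbrev LaterNbr {p : ℕ} (H : SimpleGraph (Fin p)) (j : Fin p) : Type :=
  {k : Fin p // j < k ∧ H.Adj k j}

/-- The vector `A^>_{·j}`. -/
def laterCol {p : ℕ} (H : SimpleGraph (Fin p)) (A : Matrix (Fin p) (Fin p) ℝ) (j : Fin p) :
    LaterNbr H j → ℝ :=
  fun k => A k j

/-- The matrix `A^{>j}`. -/
def laterBlock {p : ℕ} (H : SimpleGraph (Fin p)) (A : Matrix (Fin p) (Fin p) ℝ) (j : Fin p) :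
    Matrix (LaterNbr H j) (LaterNbr H j) ℝ :=
  fun k l => A k l

open Classical in
/-- The vector `(S^{>j})⁻¹ S^>_{·j}`. -/
noncomputable def regCoef {p : ℕ} (H : SimpleGraph (Fin p)) (S : Matrix (Fin p) (Fin p) ℝ)
    (j : Fin p) : LaterNbr H j → ℝ :=
  (laterBlock H S j)⁻¹ *ᵥ laterCol H S j

open Classical in
/-- The quantity `S_{jj} - (S^>_{·j})ᵀ (S^{>j})⁻¹ S^>_{·j}`. -/
noncomputable def residVar {p : ℕ} (H : SimpleGraph (Fin p)) (S : Matrix (Fin p) (Fin p) ℝ)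
    (j : Fin p) : ℝ :=
  S j j - laterCol H S j ⬝ᵥ regCoef H S j

open Classical in
/-- Step I of CCA: the Cholesky factor `L̂^D` of the Gaussian maximum likelihood estimator for the
decomposable ordered graph `H`, by its closed form. -/
noncomputable def stepOne {p : ℕ} (H : SimpleGraph (Fin p)) (S : Matrix (Fin p) (Fin p) ℝ) :
    Matrix (Fin p) (Fin p) ℝ :=
  fun i j =>
    if h : j < i ∧ H.Adj i j then -(regCoef H S j ⟨i, h⟩) / √(residVar H S j)
    else if i = j then 1 / √(residVar H S j)
    else 0

open Classical in
/-- Step II of CCA: row by row, and in each row from left to right, every entry `(i,j)` with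
`j < i` that is not an edge of `G_σ` is replaced by `-(∑_{k<j} L̂_{ik} L̂_{jk}) / L̂_{jj}`. The
entries on the right are those already updated. -/
noncomputable def stepTwo {p : ℕ} (G : SimpleGraph (Fin p)) (L : Matrix (Fin p) (Fin p) ℝ)
    (i j : Fin p) : ℝ :=
  if h : j < i ∧ ¬ G.Adj i j then
    -(∑ k : {k : Fin p // k < j}, stepTwo G L i k.1 * stepTwo G L j k.1) / stepTwo G L j j
  else L i j
termination_by ((i : ℕ), (j : ℕ))
decreasing_by
  · exact Prod.Lex.right _ k.2
  · exact Prod.Lex.left _ _ h.1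
  · exact Prod.Lex.left _ _ h.1

/-- The CCA estimator `L̂` for the ordered graph `G_σ`, from the sample covariance matrix. -/
noncomputable def ccaL {p : ℕ} (G : SimpleGraph (Fin p)) (S : Matrix (Fin p) (Fin p) ℝ) :
    Matrix (Fin p) (Fin p) ℝ :=
  Matrix.of (stepTwo G (stepOne (filledGraph G) S))

/-- The CCA estimator `Ω̂ = L̂ L̂ᵀ`. -/
noncomputable def ccaOmega {p : ℕ} (G : SimpleGraph (Fin p)) (S : Matrix (Fin p) (Fin p) ℝ) :
    Matrix (Fin p) (Fin p) ℝ :=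
  ccaL G S * (ccaL G S)ᵀ

/-! ### The data -/

/-- `Y₁, …, Yₙ` are i.i.d. random vectors with mean `0` and covariance matrix `Ω⁻¹`. -/
structure IsIIDSample {n p : ℕ} {X : Type*} [MeasurableSpace X] (P : Measure X)
    (Y : Fin n → X → Fin p → ℝ) (Ω : Matrix (Fin p) (Fin p) ℝ) : Prop where
  measurable : ∀ i, Measurable (Y i)
  indep : iIndepFun Y P
  ident : ∀ i j, IdentDistrib (Y i) (Y j) P P
  memLp : ∀ i a, MemLp (fun ω => Y i ω a) 2 P
  mean : ∀ i a, ∫ ω, Y i ω a ∂P = 0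
  cov : ∀ i a b, ∫ ω, Y i ω a * Y i ω b ∂P = (Ω⁻¹) a b

/-! ### Reverse Cuthill-McKee orderings of the cycle -/

/-! The estimator is a locally Lipschitz function of `S` near `Ω⁻¹`, entry by entry and with
constants free of `p`; concentration of `S` does the rest.

Geometry: an RCM ordering of a cycle has bandwidth two, and filling preserves this
(`IsRCMOrdering.adj_le_add_two`, `FillAdj.le_add_two`). The explicit edge set is never needed. Hence
each regression in Step I has at most two covariates, and both Cholesky factors have at most two
subdiagonals.

Step I (`exists_stepOne_bound`): the true `L` solves the same normal equations with `Ω⁻¹` in place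
of `S`, because `Lᵀ Ω⁻¹ = L⁻¹` is lower triangular. The spectral bounds make these small systems
stable.

Step II (`abs_stepTwo_sub_le`): the true `L` also satisfies the completion formula at every
non-edge. On the second subdiagonal the formula gives `0`. On the first it reads `L_{i,i-1} =
-L_{i,i-2} L_{i-1,i-2} / L_{i-1,i-1}`, so errors travel down the whole subdiagonal. Divided by
`L_{ii}`, the error is multiplied at each step by about `|L_{i,i-2}| / L_{ii} ≤ ξ < 1`; the errors
thus sum like a geometric series and remain bounded independently of `p`.

Probability (`exists_sampleCov_tail`): products of sub-Gaussian coordinates are sub-exponential, so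
a Bernstein bound and a union bound over `p²` entries give `max |S - Ω⁻¹| = O(√(log p / n))` with
probability at least `1 - 2/p`. A banded matrix has at most `5p` nonzero entries and `p ≤ |E| + 1`,
which turns the entrywise rate into the Frobenius rate. -/

lemma orderedGraph_adj {V : Type*} {p : ℕ} (G : SimpleGraph V) (σ : V ≃ Fin p) (i j : Fin p) :
    (orderedGraph G σ).Adj i j ↔ G.Adj (σ.symm i) (σ.symm j) := by
  conv_lhs => rw [← σ.apply_symm_apply i, ← σ.apply_symm_apply j]
  exact SimpleGraph.map_adj_apply

lemma cycleGraph_neighbors {p : ℕ} {w a b c : Fin p}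
    (ha : (SimpleGraph.cycleGraph p).Adj w a) (hb : (SimpleGraph.cycleGraph p).Adj w b)
    (hc : (SimpleGraph.cycleGraph p).Adj w c) : a = b ∨ a = c ∨ b = c := by
  obtain _ | p := p
  · exact w.elim0
  have key : ∀ x, (SimpleGraph.cycleGraph (p + 1)).Adj w x → x = w + 1 ∨ x = w - 1 := by
    intro x hx
    rw [SimpleGraph.cycleGraph_eq_circulantGraph, SimpleGraph.circulantGraph,
      SimpleGraph.fromRel_adj] at hx
    obtain ⟨-, h | h⟩ := hx
    · right
      rw [Set.mem_singleton_iff] at h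
      rw [← h]; abel
    · left
      rw [Set.mem_singleton_iff] at h
      rw [← h]; abel
  rcases key a ha with h1 | h1 <;> rcases key b hb with h2 | h2 <;>
    rcases key c hc with h3 | h3 <;> simp [h1, h2, h3]

/-- In a Cuthill-McKee ordering of a graph of maximal degree two, the parent of a vertex is at
distance at most two. -/
lemma IsCuthillMcKeeOrdering.le_parent_add_two {V : Type*} {p : ℕ} {G : SimpleGraph V}
    {τ : V ≃ Fin p} (h : IsCuthillMcKeeOrdering G τ)
    (hdeg : ∀ w a b c, G.Adj w a → G.Adj w b → G.Adj w c → a = b ∨ a = c ∨ b = c)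
    (m : ℕ) : ∀ v w : Fin p, (v : ℕ) = m → IsParent (orderedGraph G τ) w v →
      (v : ℕ) ≤ w + 2 := by
  have hdeg' : ∀ w a b c, (orderedGraph G τ).Adj w a → (orderedGraph G τ).Adj w b →
      (orderedGraph G τ).Adj w c → a = b ∨ a = c ∨ b = c := by
    intro w a b c ha hb hc
    rw [orderedGraph_adj] at ha hb hc
    simpa using hdeg _ _ _ _ ha hb hc
  induction m with
  | zero => intro v w hv _; omega
  | succ m ih =>
    intro v w hv hw
    by_contra hlt
    have hv3 : 3 ≤ (v : ℕ) := by omega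
    obtain ⟨w₁, hw₁⟩ := h.exists_parent ⟨m, by omega⟩ (by simp; omega)
    have h1 := ih ⟨m, by omega⟩ w₁ rfl hw₁
    have h2 := h.queue ⟨m, by omega⟩ v w₁ w (by rw [Fin.lt_def]; simp; omega) hw₁ hw
    rw [Fin.le_def] at h2
    simp only at h1
    -- The queue rule and the induction hypothesis squeeze the parents of `m` and `m + 1` to the
    -- same vertex `m - 2`. That vertex then has a third neighbour: its own parent, or vertex `1` if
    -- it is the root. This contradicts degree two.
    have hww : w₁ = w := by apply Fin.ext; omega
    subst hww
    rcases Nat.eq_zero_or_pos (w₁ : ℕ) with h0 | h0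
    · obtain ⟨w₂, hw₂⟩ := h.exists_parent ⟨1, by omega⟩ (by simp)
      have h3 : w₂ = w₁ := by
        have := hw₂.1
        rw [Fin.lt_def] at this
        simp only at this
        apply Fin.ext; omega
      subst h3
      have := hdeg' _ _ _ _ hw₁.2.1 hw.2.1 hw₂.2.1
      simp only [Fin.ext_iff] at this
      omega
    · obtain ⟨w₂, hw₂⟩ := h.exists_parent w₁ h0
      have := hdeg' _ _ _ _ hw₁.2.1 hw.2.1 hw₂.2.1.symm
      have h4 := hw₂.1
      have h5 := hw.1
      rw [Fin.lt_def] at h4 h5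
      simp only [Fin.ext_iff] at this
      omega

lemma IsCuthillMcKeeOrdering.adj_le_add_two {V : Type*} {p : ℕ} {G : SimpleGraph V}
    {τ : V ≃ Fin p} (h : IsCuthillMcKeeOrdering G τ)
    (hdeg : ∀ w a b c, G.Adj w a → G.Adj w b → G.Adj w c → a = b ∨ a = c ∨ b = c)
    {v w : Fin p} (hvw : (orderedGraph G τ).Adj w v) : (v : ℕ) ≤ w + 2 := by
  rcases Nat.eq_zero_or_pos (v : ℕ) with h0 | h0
  · omega
  · obtain ⟨u, hu⟩ := h.exists_parent v h0
    have h1 := h.le_parent_add_two hdeg _ v u rfl hu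
    have h2 := hu.2.2 w hvw
    rw [Fin.le_def] at h2
    omega

lemma orderedGraph_revPerm_adj {V : Type*} {p : ℕ} (G : SimpleGraph V) (σ : V ≃ Fin p)
    (i j : Fin p) :
    (orderedGraph G (σ.trans Fin.revPerm)).Adj i.rev j.rev ↔ (orderedGraph G σ).Adj i j := by
  simp [orderedGraph_adj]

lemma IsRCMOrdering.adj_le_add_two {p : ℕ} {σ : Fin p ≃ Fin p}
    (h : IsRCMOrdering (SimpleGraph.cycleGraph p) σ) {i j : Fin p}
    (hij : (orderedGraph (SimpleGraph.cycleGraph p) σ).Adj i j) : (i : ℕ) ≤ j + 2 := by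
  rw [← orderedGraph_revPerm_adj] at hij
  have := IsCuthillMcKeeOrdering.adj_le_add_two h
    (fun _ _ _ _ ha hb hc => cycleGraph_neighbors ha hb hc) hij
  simp only [Fin.val_rev] at this
  omega

/-- Every vertex but the last has a later neighbour, namely its parent in the reversed order.
Choosing one such edge per vertex is injective, since the vertex is the smaller endpoint. This is
what lets `|E| + 1` absorb the dimension. -/
lemma IsRCMOrdering.le_ncard_edgeSet {V : Type*} {p : ℕ} {G : SimpleGraph V} {σ : V ≃ Fin p}
    (h : IsRCMOrdering G σ) : p ≤ (orderedGraph G σ).edgeSet.ncard + 1 := by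
  have hex : ∀ v : Fin p, (v : ℕ) + 1 < p → ∃ w, v < w ∧ (orderedGraph G σ).Adj v w := by
    intro v hv
    obtain ⟨w, hw⟩ := h.exists_parent v.rev (by simp only [Fin.val_rev]; omega)
    refine ⟨w.rev, ?_, ?_⟩
    · have := hw.1
      rw [← Fin.rev_lt_rev]; simpa using this
    · rw [← orderedGraph_revPerm_adj]; simpa using hw.2.1.symm
  obtain _ | p := p
  · omega
  have hex' : ∀ v : Fin p, ∃ w, v.castSucc < w ∧ (orderedGraph G σ).Adj v.castSucc w :=
    fun v => hex _ (by simp)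
  choose f hf hadj using hex'
  let e : Fin p → (orderedGraph G σ).edgeSet := fun v => ⟨s(v.castSucc, f v), hadj v⟩
  have he : Function.Injective e := by
    intro u v huv
    have huv' : s(u.castSucc, f u) = s(v.castSucc, f v) := congrArg Subtype.val huv
    rw [Sym2.eq_iff] at huv'
    rcases huv' with ⟨h1, -⟩ | ⟨h1, h2⟩
    · exact Fin.castSucc_injective _ h1
    · have h3 := hf u
      have h4 := hf v
      rw [h2] at h3
      rw [← h1] at h4
      exact absurd h3 (not_lt.mpr h4.le)
  have := Nat.card_le_card_of_injective e he
  rw [Nat.card_eq_fintype_card, Fintype.card_fin] at this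
  exact Nat.succ_le_succ this

/-! ### The filled graph and the support of the Cholesky factor -/

lemma FillAdj.le_add_two {p : ℕ} {G : SimpleGraph (Fin p)}
    (hG : ∀ i j, G.Adj i j → (i : ℕ) ≤ j + 2) {i j : Fin p} (h : FillAdj G i j) :
    (i : ℕ) ≤ j + 2 := by
  -- Two later neighbours of `k` both lie in `{k + 1, k + 2}`, so fill edges have length one. The
  -- two-sided bound is what the induction carries through.
  have : (i : ℕ) ≤ j + 2 ∧ (j : ℕ) ≤ i + 2 := by
    induction h with
    | base h => exact ⟨hG _ _ h, hG _ _ h.symm⟩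
    | fill hi hj hij _ _ ih₁ ih₂ =>
      rw [Fin.lt_def] at hi hj
      omega
  exact this.1

lemma IsCholeskyFactor.mul_apply {p : ℕ} {L A : Matrix (Fin p) (Fin p) ℝ}
    (hL : IsCholeskyFactor L A) (i j : Fin p) :
    A i j = ∑ k, L i k * L j k := by
  rw [hL.eq, Matrix.mul_apply]; rfl

lemma sum_eq_sum_lt_add {p : ℕ} {f : Fin p → ℝ} {j : Fin p} (hf : ∀ k, j < k → f k = 0) :
    ∑ k, f k = ∑ k : {k : Fin p // k < j}, f k.1 + f j := by
  have h1 : ∑ k : {k : Fin p // k < j}, f k.1 = ∑ k ∈ Finset.univ.filter (· < j), f k :=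
    (Finset.sum_subtype _ (by simp) f).symm
  rw [h1, add_comm, ← Finset.sum_insert (by simp)]
  symm
  apply Finset.sum_subset (Finset.subset_univ _)
  intro k _ hk
  simp only [Finset.mem_insert, Finset.mem_filter, Finset.mem_univ, true_and, not_or,
    not_lt] at hk
  exact hf k (lt_of_le_of_ne hk.2 (Ne.symm hk.1))

/-- An entry of the Cholesky factor at a vanishing entry of the matrix is determined by the
entries to its left. -/
lemma IsCholeskyFactor.apply_eq_of_eq_zero {p : ℕ} {L A : Matrix (Fin p) (Fin p) ℝ}
    (hL : IsCholeskyFactor L A) {i j : Fin p} (h : A i j = 0) :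
    L i j = -(∑ k : {k : Fin p // k < j}, L i k.1 * L j k.1) / L j j := by
  have h1 := hL.mul_apply i j
  rw [sum_eq_sum_lt_add (j := j) (fun k hk => by rw [hL.lower j k hk, mul_zero]), h] at h1
  rw [eq_div_iff (hL.diag_pos j).ne']
  linarith

/-- Induction on the column: a nonzero product `L i k * L j k` with `k < j` would make `(i,k)` and
`(j,k)` filled edges, and elimination of `k` would then join `i` to `j`. -/
lemma IsCholeskyFactor.eq_zero_of_not_fillAdj {p : ℕ} {G : SimpleGraph (Fin p)}
    {L A : Matrix (Fin p) (Fin p) ℝ} (hL : IsCholeskyFactor L A) (hA : A ∈ concentrationSet G)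
    (m : ℕ) : ∀ i j : Fin p, (j : ℕ) = m → j < i → ¬ FillAdj G i j → L i j = 0 := by
  induction m using Nat.strong_induction_on with
  | _ m ih =>
    intro i j hj hij hnot
    rw [hL.apply_eq_of_eq_zero (hA.2 i j hij.ne' fun h => hnot (.base h))]
    rw [Finset.sum_eq_zero, neg_zero, zero_div]
    rintro ⟨k, hk⟩ -
    by_contra hne
    rw [mul_eq_zero, not_or] at hne
    have hk' : (k : ℕ) < m := by rw [← hj]; exact hk
    have h1 : FillAdj G i k := by
      by_contra h
      exact hne.1 (ih k hk' i k rfl (hk.trans hij) h)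
    have h2 : FillAdj G j k := by
      by_contra h
      exact hne.2 (ih k hk' j k rfl hk h)
    exact hnot (.fill (hk.trans hij) hk hij.ne' h1 h2)

/-! ### Spectral bounds -/

section Spectrum

variable {ι : Type*} [Fintype ι] [DecidableEq ι] {A : Matrix ι ι ℝ} {δ : ℝ}

lemma posSemidef_sub_smul_one_of_spectrum (hA : A.IsHermitian) {r : ℝ}
    (h : ∀ t ∈ spectrum ℝ A, r ≤ t) : (A - r • (1 : Matrix ι ι ℝ)).PosSemidef := by
  have hH : (A - r • (1 : Matrix ι ι ℝ)).IsHermitian := by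
    refine hA.sub ?_
    simp [Matrix.IsHermitian]
  rw [hH.posSemidef_iff_eigenvalues_nonneg]
  intro i
  have h1 := hH.eigenvalues_mem_spectrum_real i
  have h2 := spectrum.sub_singleton_eq (R := ℝ) A r
  rw [Algebra.algebraMap_eq_smul_one] at h2
  rw [← h2] at h1
  obtain ⟨t, ht, s, hs, hts⟩ := h1
  rw [Set.mem_singleton_iff] at hs
  have := h t ht
  simp only at hts
  simp only [Pi.zero_apply]
  linarith

lemma apply_self_le_of_spectrum (hA : A.IsHermitian) {r : ℝ}
    (h : ∀ t ∈ spectrum ℝ A, t ≤ r) (i : ι) : A i i ≤ r := by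
  have h1 : (-A - (-r) • (1 : Matrix ι ι ℝ)).PosSemidef := by
    apply posSemidef_sub_smul_one_of_spectrum hA.neg
    intro t ht
    rw [← spectrum.neg_eq] at ht
    have := h (-t) ht
    linarith
  have := h1.diag_nonneg (i := i)
  simp at this
  linarith

/-- The interval `[δ, δ⁻¹]` is invariant under inversion, so the covariance matrix inherits the same
constant. -/
lemma spectrum_inv_bounds (hA : A.PosDef) (hδ : 0 < δ)
    (h : ∀ t ∈ spectrum ℝ A, δ ≤ t ∧ t ≤ δ⁻¹) : ∀ t ∈ spectrum ℝ A⁻¹, δ ≤ t ∧ t ≤ δ⁻¹ := by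
  intro t ht
  obtain ⟨u, hu⟩ := hA.isUnit
  have h1 := spectrum.map_inv (𝕜 := ℝ) u
  rw [Matrix.coe_units_inv, hu] at h1
  rw [← h1, Set.mem_inv] at ht
  obtain ⟨h2, h3⟩ := h _ ht
  have h4 : 0 < t⁻¹ := hδ.trans_le h2
  have h5 : 0 < t := inv_pos.mp h4
  exact ⟨(inv_le_inv₀ h5 hδ).mp h3, (le_inv_comm₀ hδ h5).mp h2⟩

end Spectrum

/-! ### Cholesky factors of well-conditioned matrices -/

section Cholesky

variable {p : ℕ} {L Ω : Matrix (Fin p) (Fin p) ℝ} {δ : ℝ}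

lemma IsCholeskyFactor.isUnit_det (hL : IsCholeskyFactor L Ω) : IsUnit L.det := by
  rw [Matrix.det_of_isLowerTriangular L (fun i j h => hL.lower i j h)]
  exact (Finset.prod_pos fun i _ => hL.diag_pos i).ne'.isUnit

lemma IsCholeskyFactor.transpose_mul_inv (hL : IsCholeskyFactor L Ω) : Lᵀ * Ω⁻¹ = L⁻¹ := by
  have h := hL.isUnit_det
  rw [hL.eq, Matrix.mul_inv_rev, ← Matrix.mul_assoc, Matrix.mul_nonsing_inv, Matrix.one_mul]
  rwa [Matrix.det_transpose]

lemma IsCholeskyFactor.inv_apply_eq_zero (hL : IsCholeskyFactor L Ω) {i j : Fin p} (h : i < j) :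
    L⁻¹ i j = 0 := by
  have hL' : L.BlockTriangular OrderDual.toDual := fun i j h => hL.lower i j h
  let _ : Invertible L := L.invertibleOfIsUnitDet hL.isUnit_det
  exact Matrix.blockTriangular_inv_of_blockTriangular hL' h

lemma IsCholeskyFactor.inv_apply_self (hL : IsCholeskyFactor L Ω) (j : Fin p) :
    L⁻¹ j j = 1 / L j j := by
  have h := congrFun (congrFun (Matrix.mul_nonsing_inv L hL.isUnit_det) j) j
  rw [Matrix.mul_apply, Finset.sum_eq_single j, Matrix.one_apply_eq] at h
  · rw [eq_div_iff (hL.diag_pos j).ne', mul_comm]; exact h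
  · intro k _ hk
    rcases lt_or_gt_of_ne hk with h' | h'
    · rw [hL.inv_apply_eq_zero h', mul_zero]
    · rw [hL.lower j k h', zero_mul]
  · simp

lemma IsCholeskyFactor.sq_le (hL : IsCholeskyFactor L Ω) (i j : Fin p) : L i j ^ 2 ≤ Ω i i := by
  rw [hL.mul_apply i i, sq]
  exact Finset.single_le_sum (f := fun k => L i k * L i k)
    (fun k _ => mul_self_nonneg _) (Finset.mem_univ j)

/-- The diagonal entry of `Ω⁻¹ = (L⁻¹)ᵀ L⁻¹` is a sum of squares, one of which is `(L⁻¹ j j)²`. It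
serves to bound the diagonal of `L` away from zero. -/
lemma IsCholeskyFactor.one_div_sq_le (hL : IsCholeskyFactor L Ω) (j : Fin p) :
    1 / L j j ^ 2 ≤ Ω⁻¹ j j := by
  have h1 : Ω⁻¹ = (L⁻¹)ᵀ * L⁻¹ := by
    rw [hL.eq, Matrix.mul_inv_rev, Matrix.transpose_nonsing_inv]
  rw [h1, Matrix.mul_apply]
  have h2 : (1 : ℝ) / L j j ^ 2 = L⁻¹ j j * L⁻¹ j j := by
    rw [hL.inv_apply_self]; field_simp
  rw [h2]
  exact Finset.single_le_sum (f := fun k => (L⁻¹)ᵀ j k * L⁻¹ k j)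
    (fun k _ => mul_self_nonneg _) (Finset.mem_univ j)

end Cholesky

/-! ### Perturbation of regression coefficients -/

section Regression

variable {N : Type*} [Fintype N]

lemma abs_sum_le_of_card_le_two (hN : Fintype.card N ≤ 2) {f : N → ℝ} {b : ℝ} (hb : 0 ≤ b)
    (hf : ∀ k, |f k| ≤ b) : |∑ k, f k| ≤ 2 * b := by
  calc |∑ k, f k| ≤ ∑ k, |f k| := Finset.abs_sum_le_sum_abs _ _
    _ ≤ ∑ _k : N, b := Finset.sum_le_sum fun k _ => hf k
    _ = Fintype.card N * b := by simp
    _ ≤ 2 * b := by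
      apply mul_le_mul_of_nonneg_right _ hb
      exact_mod_cast hN

lemma quadratic_form_perturbation (hN : Fintype.card N ≤ 2) {A B : Matrix N N ℝ} {δ ε : ℝ}
    (hA : ∀ x : N → ℝ, δ * ∑ k, x k ^ 2 ≤ x ⬝ᵥ A *ᵥ x) (hε0 : 0 ≤ ε) (hε : ε ≤ δ / 4)
    (hAB : ∀ k l, |B k l - A k l| ≤ ε) (x : N → ℝ) :
    δ / 2 * ∑ k, x k ^ 2 ≤ x ⬝ᵥ B *ᵥ x := by
  have h1 : x ⬝ᵥ B *ᵥ x - x ⬝ᵥ A *ᵥ x = ∑ k, ∑ l, x k * (B k l - A k l) * x l := by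
    simp only [dotProduct, mulVec, Finset.mul_sum, ← Finset.sum_sub_distrib]
    refine Finset.sum_congr rfl fun k _ => Finset.sum_congr rfl fun l _ => by ring
  have h2 : |∑ k, ∑ l, x k * (B k l - A k l) * x l| ≤ ε * (∑ k, |x k|) ^ 2 := by
    calc |∑ k, ∑ l, x k * (B k l - A k l) * x l|
        ≤ ∑ k, ∑ l, |x k| * ε * |x l| := by
          refine (Finset.abs_sum_le_sum_abs _ _).trans (Finset.sum_le_sum fun k _ => ?_)
          refine (Finset.abs_sum_le_sum_abs _ _).trans (Finset.sum_le_sum fun l _ => ?_)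
          rw [abs_mul, abs_mul]
          gcongr
          exact hAB k l
      _ = ε * (∑ k, |x k|) ^ 2 := by
          rw [sq, Finset.sum_mul_sum, Finset.mul_sum]
          refine Finset.sum_congr rfl fun k _ => ?_
          rw [Finset.mul_sum]
          exact Finset.sum_congr rfl fun l _ => by ring
  -- Cauchy–Schwarz costs only the number of covariates, here at most two.
  have h3 : (∑ k, |x k|) ^ 2 ≤ 2 * ∑ k, x k ^ 2 := by
    have h := sq_sum_le_card_mul_sum_sq (s := Finset.univ) (f := fun k => |x k|)
    simp only [sq_abs] at h
    refine h.trans ?_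
    apply mul_le_mul_of_nonneg_right _ (Finset.sum_nonneg fun k _ => sq_nonneg _)
    exact_mod_cast hN
  have h4 := abs_le.mp h2
  have h5 := hA x
  have h6 : 0 ≤ ∑ k, x k ^ 2 := Finset.sum_nonneg fun k _ => sq_nonneg _
  have h7 : ε * (∑ k, |x k|) ^ 2 ≤ δ / 4 * (2 * ∑ k, x k ^ 2) :=
    mul_le_mul hε h3 (sq_nonneg _) (hε0.trans hε)
  linarith [h4.1]

/-- Stability of a linear system: `x = B⁻¹ v - β` has residual `B x = (v - A β) - (B - A) β`, which
is of order `ε`, and coercivity of `B` bounds `x` by its residual. The Young inequality `x r ≤ (δ/4)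
x² + r²/δ` leaves half of the coercive term. -/
lemma abs_inv_mulVec_sub_le [DecidableEq N] (hN : Fintype.card N ≤ 2) {A B : Matrix N N ℝ} {δ ε M : ℝ}
    (hδ : 0 < δ) (hA : ∀ x : N → ℝ, δ * ∑ k, x k ^ 2 ≤ x ⬝ᵥ A *ᵥ x) (hε0 : 0 ≤ ε)
    (hε : ε ≤ δ / 4) (hAB : ∀ k l, |B k l - A k l| ≤ ε) {v β : N → ℝ} (hM : 0 ≤ M)
    (hv : ∀ k, |v k - (A *ᵥ β) k| ≤ ε) (hβ : ∀ k, |β k| ≤ M) (k : N) :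
    |(B⁻¹ *ᵥ v) k - β k| ≤ 4 / δ * (1 + 2 * M) * ε := by
  have hB := quadratic_form_perturbation hN hA hε0 hε hAB
  have hunit : IsUnit B := by
    rw [← Matrix.mulVec_injective_iff_isUnit]
    intro x y hxy
    have h1 := hB (x - y)
    rw [Matrix.mulVec_sub, hxy, sub_self, dotProduct_zero] at h1
    have h2 : ∑ k, (x - y) k ^ 2 = 0 :=
      le_antisymm (by
        by_contra hcon
        push Not at hcon
        have : 0 < δ / 2 * ∑ k, (x - y) k ^ 2 := by positivity
        linarith) (Finset.sum_nonneg fun k _ => sq_nonneg _)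
    rw [Finset.sum_eq_zero_iff_of_nonneg (fun k _ => sq_nonneg _)] at h2
    funext k
    have := h2 k (Finset.mem_univ k)
    rw [sq_eq_zero_iff, Pi.sub_apply, sub_eq_zero] at this
    exact this
  set x : N → ℝ := B⁻¹ *ᵥ v - β with hx
  set r : N → ℝ := B *ᵥ x with hr
  have hr' : ∀ k, r k = (v k - (A *ᵥ β) k) - ∑ l, (B k l - A k l) * β l := by
    intro k
    rw [hr, hx, Matrix.mulVec_sub, Matrix.mulVec_mulVec,
      Matrix.mul_nonsing_inv _ ((Matrix.isUnit_iff_isUnit_det _).mp hunit), Matrix.one_mulVec]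
    simp only [Pi.sub_apply, mulVec, dotProduct, sub_mul, Finset.sum_sub_distrib]
    ring
  have hrb : ∀ k, |r k| ≤ (1 + 2 * M) * ε := by
    intro k
    rw [hr' k]
    have h1 : |∑ l, (B k l - A k l) * β l| ≤ 2 * (ε * M) := by
      refine abs_sum_le_of_card_le_two hN (by positivity) fun l => ?_
      rw [abs_mul]
      exact mul_le_mul (hAB k l) (hβ l) (abs_nonneg _) hε0
    have h2 := abs_sub (v k - (A *ᵥ β) k) (∑ l, (B k l - A k l) * β l)
    have h3 := hv k
    linarith
  have hquad : δ / 2 * ∑ k, x k ^ 2 ≤ δ / 4 * ∑ k, x k ^ 2 + 1 / δ * ∑ k, r k ^ 2 := by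
    refine (hB x).trans ?_
    rw [dotProduct, Finset.mul_sum, Finset.mul_sum, ← Finset.sum_add_distrib]
    refine Finset.sum_le_sum fun k _ => ?_
    have h1 : δ / 4 * x k ^ 2 + 1 / δ * r k ^ 2 - x k * r k
        = 1 / δ * (δ / 2 * x k - r k) ^ 2 := by
      field_simp; ring
    have h2 : 0 ≤ 1 / δ * (δ / 2 * x k - r k) ^ 2 := by positivity
    change x k * r k ≤ _
    linarith
  have hrs : ∑ k, r k ^ 2 ≤ 2 * ((1 + 2 * M) * ε) ^ 2 := by
    refine (le_abs_self _).trans (abs_sum_le_of_card_le_two hN (sq_nonneg _) fun k => ?_)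
    rw [abs_of_nonneg (sq_nonneg _), ← sq_abs]
    gcongr
    exact hrb k
  have hxk : x k ^ 2 ≤ ∑ k, x k ^ 2 :=
    Finset.single_le_sum (f := fun k => x k ^ 2) (fun k _ => sq_nonneg _) (Finset.mem_univ k)
  have hfin : x k ^ 2 ≤ (4 / δ * (1 + 2 * M) * ε) ^ 2 := by
    have h1 : δ / 4 * x k ^ 2 ≤ 1 / δ * (2 * ((1 + 2 * M) * ε) ^ 2) := by
      have h2 : δ / 4 * x k ^ 2 ≤ δ / 4 * ∑ k, x k ^ 2 := by gcongr
      have h3 : 1 / δ * ∑ k, r k ^ 2 ≤ 1 / δ * (2 * ((1 + 2 * M) * ε) ^ 2) := by gcongr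
      linarith
    have h2 : x k ^ 2 ≤ 4 / δ * (1 / δ * (2 * ((1 + 2 * M) * ε) ^ 2)) := by
      calc x k ^ 2 = 4 / δ * (δ / 4 * x k ^ 2) := by field_simp
        _ ≤ _ := by gcongr
    refine h2.trans ?_
    have h3 : (4 / δ * (1 + 2 * M) * ε) ^ 2 - 4 / δ * (1 / δ * (2 * ((1 + 2 * M) * ε) ^ 2))
        = 8 / δ ^ 2 * ((1 + 2 * M) * ε) ^ 2 := by field_simp; ring
    have h4 : 0 ≤ 8 / δ ^ 2 * ((1 + 2 * M) * ε) ^ 2 := by positivity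
    linarith
  exact abs_le_of_sq_le_sq hfin (by positivity)

end Regression

lemma one_div_sqrt_le {η a : ℝ} (hη : 0 < η) (ha : η ≤ a) : 1 / √a ≤ 1 / √η :=
  one_div_le_one_div_of_le (Real.sqrt_pos.mpr hη) (Real.sqrt_le_sqrt ha)

lemma abs_one_div_sqrt_sub_le {η a b : ℝ} (hη : 0 < η) (ha : η ≤ a) (hb : η ≤ b) :
    |1 / √a - 1 / √b| ≤ (1 / √η) ^ 3 * |a - b| := by
  have ha' : 0 < √a := Real.sqrt_pos.mpr (hη.trans_le ha)
  have hb' : 0 < √b := Real.sqrt_pos.mpr (hη.trans_le hb)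
  have h1 : 1 / √a - 1 / √b = -(1 / √a * (1 / √b) * (1 / (√a + √b))) * (a - b) := by
    have h2 : a - b = √a ^ 2 - √b ^ 2 := by
      rw [Real.sq_sqrt (hη.le.trans ha), Real.sq_sqrt (hη.le.trans hb)]
    rw [h2]
    field_simp
    ring
  rw [h1, abs_mul, abs_neg, abs_of_pos (by positivity)]
  have h2 : 1 / (√a + √b) ≤ 1 / √η :=
    (one_div_le_one_div_of_le ha' (by linarith)).trans (one_div_sqrt_le hη ha)
  have h3 := one_div_sqrt_le hη ha
  have h4 := one_div_sqrt_le hη hb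
  calc _ ≤ 1 / √η * (1 / √η) * (1 / √η) * |a - b| := by gcongr
    _ = _ := by ring

/-- Test the quadratic form on `e_i ± e_j`. -/
lemma Matrix.PosSemidef.abs_apply_le {ι : Type*} [Fintype ι] [DecidableEq ι] {A : Matrix ι ι ℝ}
    (hA : A.PosSemidef) {r : ℝ} (h : ∀ i, A i i ≤ r) (i j : ι) : |A i j| ≤ r := by
  have hsymm : A j i = A i j := by simpa using hA.isHermitian.apply i j
  have h1 := hA.dotProduct_mulVec_nonneg (Pi.single i 1 + Pi.single j 1)
  have h2 := hA.dotProduct_mulVec_nonneg (Pi.single i 1 - Pi.single j 1)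
  simp [mulVec_add, mulVec_sub, add_dotProduct, sub_dotProduct, hsymm] at h1 h2
  have := h i
  have := h j
  rw [abs_le]
  constructor <;> linarith

/-! ### Step I -/

section StepOne

variable {p : ℕ} {H : SimpleGraph (Fin p)} {L Ω : Matrix (Fin p) (Fin p) ℝ} {δ : ℝ}

lemma card_laterNbr_le_two (hH : ∀ i j, H.Adj i j → (i : ℕ) ≤ j + 2) (j : Fin p)
    [Fintype (LaterNbr H j)] : Fintype.card (LaterNbr H j) ≤ 2 := by
  let e : LaterNbr H j → Fin 2 := fun k => ⟨k.1 - j - 1, by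
    have h1 := hH _ _ k.2.2
    have h2 := k.2.1
    rw [Fin.lt_def] at h2
    omega⟩
  have he : Function.Injective e := by
    intro k l hkl
    simp only [e, Fin.mk.injEq] at hkl
    have h1 := k.2.1
    have h2 := l.2.1
    rw [Fin.lt_def] at h1 h2
    apply Subtype.ext
    apply Fin.ext
    omega
  simpa using Fintype.card_le_of_injective e he

lemma sum_eq_add_sum_laterNbr (j : Fin p) [Fintype (LaterNbr H j)] {f : Fin p → ℝ}
    (hf : ∀ k, k ≠ j → ¬ (j < k ∧ H.Adj k j) → f k = 0) :
    ∑ k, f k = f j + ∑ k : LaterNbr H j, f k := by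
  classical
  have h1 : ∑ k : LaterNbr H j, f k = ∑ k ∈ Finset.univ.filter (fun k => j < k ∧ H.Adj k j), f k :=
    (Finset.sum_subtype _ (by simp) f).symm
  rw [h1, ← Finset.sum_insert (by simp)]
  symm
  apply Finset.sum_subset (Finset.subset_univ _)
  intro k _ hk
  simp only [Finset.mem_insert, Finset.mem_filter, Finset.mem_univ, true_and, not_or] at hk
  exact hf k hk.1 hk.2

/-- Row `j` of `Lᵀ Ω⁻¹ = L⁻¹`, restricted to the support of column `j` of `L`. For `m > j` the right
side vanishes, giving the normal equations for the coefficients `-L k j / L j j`; for `m = j` it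
gives the residual variance `1 / L j j ^ 2`. -/
lemma IsCholeskyFactor.sum_laterNbr_mul_inv (hL : IsCholeskyFactor L Ω)
    (hLH : ∀ i j, j < i → ¬ H.Adj i j → L i j = 0) (j m : Fin p) [Fintype (LaterNbr H j)] :
    L j j * Ω⁻¹ j m + ∑ k : LaterNbr H j, L k j * Ω⁻¹ k m = L⁻¹ j m := by
  rw [← hL.transpose_mul_inv, Matrix.mul_apply]
  symm
  refine sum_eq_add_sum_laterNbr j (f := fun k => Lᵀ j k * Ω⁻¹ k m) fun k hk hnot => ?_
  have : L k j = 0 := by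
    rcases lt_or_gt_of_ne hk with h | h
    · exact hL.lower k j h
    · exact hLH k j h fun h' => hnot ⟨h, h'⟩
  simp [Matrix.transpose_apply, this]

/-- The first step of CCA is Lipschitz at the true covariance matrix, entry by entry. -/
theorem exists_stepOne_bound (hδ : 0 < δ) : ∃ C ε₀ : ℝ, 0 < C ∧ 0 < ε₀ ∧
    ∀ (p : ℕ) (H : SimpleGraph (Fin p)) (L Ω S : Matrix (Fin p) (Fin p) ℝ) (ε : ℝ),
      (∀ i j, H.Adj i j → (i : ℕ) ≤ j + 2) → Ω.PosDef →
      (∀ t ∈ spectrum ℝ Ω, δ ≤ t ∧ t ≤ δ⁻¹) → IsCholeskyFactor L Ω →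
      (∀ i j, j < i → ¬ H.Adj i j → L i j = 0) → 0 ≤ ε → ε ≤ ε₀ →
      (∀ i j, |S i j - Ω⁻¹ i j| ≤ ε) →
      ∀ i j, |stepOne H S i j - L i j| ≤ C * ε := by
  classical
  -- `C₁` and `C₂` are the Lipschitz constants of the regression coefficients and of the residual
  -- variance; `R` bounds the estimated diagonal entries. In the threshold, `δ / 4` keeps the
  -- regression blocks invertible, `1` makes the quadratic error term linear, and `δ / (2 * C₂)`
  -- keeps the residual variance above `δ / 2`.
  set C₁ : ℝ := 4 / δ * (1 + 2 * δ⁻¹) with hC₁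
  set C₂ : ℝ := 1 + 2 * (δ⁻¹ + C₁ + δ⁻¹ * C₁) with hC₂
  set R : ℝ := 1 / √(δ / 2) with hR
  have hC₁0 : 0 < C₁ := by positivity
  have hC₂0 : 0 < C₂ := by positivity
  have hR0 : 0 < R := by positivity
  refine ⟨C₁ * R + δ⁻¹ * (R ^ 3 * C₂) + R ^ 3 * C₂, min (min (δ / 4) 1) (δ / (2 * C₂)),
    by positivity, by positivity, ?_⟩
  intro p H L Ω S ε hH hΩ hspec hL hLH hε0 hε hS
  have hε1 : ε ≤ δ / 4 := hε.trans ((min_le_left _ _).trans (min_le_left _ _))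
  have hε2 : ε ≤ 1 := hε.trans ((min_le_left _ _).trans (min_le_right _ _))
  have hε3 : C₂ * ε ≤ δ / 2 := by
    have : ε ≤ δ / (2 * C₂) := hε.trans (min_le_right _ _)
    rw [le_div_iff₀ (by positivity)] at this
    linarith
  have hinv := hΩ.inv
  have hspec' := spectrum_inv_bounds hΩ hδ hspec
  have hΩdiag : ∀ i, Ω i i ≤ δ⁻¹ :=
    apply_self_le_of_spectrum hΩ.isHermitian fun t ht => (hspec t ht).2
  have hinvdiag : ∀ i, Ω⁻¹ i i ≤ δ⁻¹ :=
    apply_self_le_of_spectrum hinv.isHermitian fun t ht => (hspec' t ht).2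
  have hinvabs := hinv.posSemidef.abs_apply_le hinvdiag
  have hPSD := posSemidef_sub_smul_one_of_spectrum hinv.isHermitian fun t ht => (hspec' t ht).1
  have hLsq : ∀ j, δ ≤ L j j ^ 2 := by
    intro j
    have h1 := (hL.one_div_sq_le j).trans (hinvdiag j)
    have h2 : 0 < L j j ^ 2 := pow_pos (hL.diag_pos j) 2
    rw [one_div] at h1
    exact (inv_le_inv₀ h2 hδ).mp h1
  have hLle : ∀ i j, L i j ^ 2 ≤ δ⁻¹ := fun i j => (hL.sq_le i j).trans (hΩdiag i)
  have column : ∀ j, (∀ k : LaterNbr H j, |regCoef H S j k - -(L k j / L j j)| ≤ C₁ * ε ∧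
      |L k j / L j j| ≤ δ⁻¹) ∧
      |residVar H S j - 1 / L j j ^ 2| ≤ C₂ * ε ∧ δ ≤ 1 / L j j ^ 2 := by
    intro j
    have hLj := hL.diag_pos j
    have hcard := card_laterNbr_le_two hH j
    set β : LaterNbr H j → ℝ := fun k => -(L k j / L j j) with hβ
    have hβb : ∀ k, |β k| ≤ δ⁻¹ := by
      intro k
      apply abs_le_of_sq_le_sq _ (by positivity)
      rw [hβ]
      simp only [neg_sq, div_pow]
      rw [div_le_iff₀ (by positivity)]
      calc L k j ^ 2 ≤ δ⁻¹ := hLle _ _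
        _ = δ⁻¹ ^ 2 * δ := by field_simp
        _ ≤ δ⁻¹ ^ 2 * L j j ^ 2 := by gcongr; exact hLsq j
    have hquad : ∀ x : LaterNbr H j → ℝ,
        δ * ∑ k, x k ^ 2 ≤ x ⬝ᵥ laterBlock H Ω⁻¹ j *ᵥ x := by
      intro x
      have h1 := (hPSD.submatrix (Subtype.val : LaterNbr H j → Fin p)).dotProduct_mulVec_nonneg x
      have h2 : (Ω⁻¹ - δ • (1 : Matrix (Fin p) (Fin p) ℝ)).submatrix
          (Subtype.val : LaterNbr H j → Fin p) Subtype.val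
          = laterBlock H Ω⁻¹ j - δ • (1 : Matrix (LaterNbr H j) (LaterNbr H j) ℝ) := by
        ext k l
        simp [laterBlock, Matrix.one_apply, Subtype.ext_iff]
      rw [h2, Matrix.sub_mulVec, dotProduct_sub, Matrix.smul_mulVec, Matrix.one_mulVec,
        dotProduct_smul] at h1
      simp only [star_trivial, smul_eq_mul] at h1
      have h3 : x ⬝ᵥ x = ∑ k, x k ^ 2 := by simp [dotProduct, sq]
      rw [h3] at h1
      linarith
    have hnormal : ∀ m : LaterNbr H j,
        (laterBlock H Ω⁻¹ j *ᵥ β) m = Ω⁻¹ m j := by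
      intro m
      have h1 := hL.sum_laterNbr_mul_inv hLH j m
      rw [hL.inv_apply_eq_zero m.2.1] at h1
      have hsym : ∀ a b, Ω⁻¹ a b = Ω⁻¹ b a := fun a b => by
        simpa using hinv.isHermitian.apply b a
      have h2 : (laterBlock H Ω⁻¹ j *ᵥ β) m
          = -(∑ k : LaterNbr H j, L k j * Ω⁻¹ k m) / L j j := by
        simp only [mulVec, dotProduct, laterBlock, hβ]
        rw [neg_div, Finset.sum_div, ← Finset.sum_neg_distrib]
        refine Finset.sum_congr rfl fun k _ => ?_
        rw [hsym m k]; ring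
      rw [h2, hsym m j, div_eq_iff hLj.ne']
      linarith
    have hcoef : ∀ k, |regCoef H S j k - β k| ≤ C₁ * ε := by
      intro k
      exact abs_inv_mulVec_sub_le hcard (A := laterBlock H Ω⁻¹ j) hδ hquad hε0 hε1
        (fun k l => hS k l) (inv_nonneg.mpr hδ.le)
        (fun m => by rw [hnormal m]; exact hS m j) hβb k
    have hs : 1 / L j j ^ 2 = Ω⁻¹ j j - ∑ k : LaterNbr H j, Ω⁻¹ k j * β k := by
      have h1 := hL.sum_laterNbr_mul_inv hLH j j
      rw [hL.inv_apply_self] at h1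
      have h2 : ∑ k : LaterNbr H j, Ω⁻¹ k j * β k
          = -(∑ k : LaterNbr H j, L k j * Ω⁻¹ k j) / L j j := by
        rw [neg_div, Finset.sum_div, ← Finset.sum_neg_distrib]
        refine Finset.sum_congr rfl fun k _ => ?_
        rw [hβ]; ring
      rw [h2, sq, ← div_div, ← h1]
      field_simp
      ring
    refine ⟨fun k => ⟨hcoef k, by simpa [hβ] using hβb k⟩, ?_, ?_⟩
    · have h1 : residVar H S j - 1 / L j j ^ 2 = (S j j - Ω⁻¹ j j)
          - ∑ k : LaterNbr H j, (S k j * regCoef H S j k - Ω⁻¹ k j * β k) := by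
        rw [hs, residVar, Finset.sum_sub_distrib]
        simp only [dotProduct, laterCol]
        ring
      have h2 : |∑ k : LaterNbr H j, (S k j * regCoef H S j k - Ω⁻¹ k j * β k)|
          ≤ 2 * ((δ⁻¹ + C₁ + δ⁻¹ * C₁) * ε) := by
        refine abs_sum_le_of_card_le_two hcard (by positivity) fun k => ?_
        have h3 : S k j * regCoef H S j k - Ω⁻¹ k j * β k
            = (S k j - Ω⁻¹ k j) * β k + (S k j - Ω⁻¹ k j) * (regCoef H S j k - β k)
              + Ω⁻¹ k j * (regCoef H S j k - β k) := by ring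
        rw [h3]
        refine (abs_add_three _ _ _).trans ?_
        rw [abs_mul, abs_mul, abs_mul]
        have h4 : |S k j - Ω⁻¹ k j| * |β k| ≤ ε * δ⁻¹ :=
          mul_le_mul (hS _ _) (hβb k) (abs_nonneg _) hε0
        have h5 : |S k j - Ω⁻¹ k j| * |regCoef H S j k - β k| ≤ 1 * (C₁ * ε) :=
          mul_le_mul ((hS _ _).trans hε2) (hcoef k) (abs_nonneg _) zero_le_one
        have h6 : |Ω⁻¹ k j| * |regCoef H S j k - β k| ≤ δ⁻¹ * (C₁ * ε) :=
          mul_le_mul (hinvabs _ _) (hcoef k) (abs_nonneg _) (by positivity)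
        linarith
      rw [h1]
      refine (abs_sub _ _).trans ?_
      have h3 := hS j j
      rw [hC₂]
      linarith
    · rw [one_div, le_inv_comm₀ hδ (by positivity)]
      exact hLle j j
  have hdiag : ∀ j, |1 / √(residVar H S j) - L j j| ≤ R ^ 3 * C₂ * ε ∧
      |1 / √(residVar H S j)| ≤ R := by
    intro j
    obtain ⟨-, h1, h2⟩ := column j
    have h3 : δ / 2 ≤ residVar H S j := by
      have := (abs_le.mp h1).1
      linarith
    have h4 : L j j = 1 / √(1 / L j j ^ 2) := by
      rw [Real.sqrt_div zero_le_one, Real.sqrt_sq (hL.diag_pos j).le, Real.sqrt_one, one_div_one_div]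
    constructor
    · have h5 := abs_one_div_sqrt_sub_le (by positivity) h3 (by linarith : δ / 2 ≤ 1 / L j j ^ 2)
      rw [← h4] at h5
      refine h5.trans ?_
      rw [← hR, mul_assoc]
      gcongr
    · rw [abs_of_nonneg (by positivity)]
      exact one_div_sqrt_le (by positivity) h3
  intro i j
  have hpos1 : 0 ≤ C₁ * R * ε := by positivity
  have hpos2 : 0 ≤ δ⁻¹ * (R ^ 3 * C₂) * ε := by positivity
  have hpos3 : 0 ≤ R ^ 3 * C₂ * ε := by positivity
  unfold stepOne
  split_ifs with h1 h2
  · obtain ⟨h2, h3⟩ := (column j).1 ⟨i, h1⟩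
    obtain ⟨h4, h5⟩ := hdiag j
    have hLj := (hL.diag_pos j).ne'
    have h6 : -regCoef H S j ⟨i, h1⟩ / √(residVar H S j) - L i j
        = -(1 / √(residVar H S j) * (regCoef H S j ⟨i, h1⟩ - -(L i j / L j j)))
          + L i j / L j j * (1 / √(residVar H S j) - L j j) := by
      field_simp
      ring
    rw [h6]
    refine (abs_add_le _ _).trans ?_
    rw [abs_neg, abs_mul, abs_mul]
    have h7 : |1 / √(residVar H S j)| * |regCoef H S j ⟨i, h1⟩ - -(L i j / L j j)|
        ≤ R * (C₁ * ε) := mul_le_mul h5 h2 (abs_nonneg _) hR0.le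
    have h8 : |L i j / L j j| * |1 / √(residVar H S j) - L j j| ≤ δ⁻¹ * (R ^ 3 * C₂ * ε) :=
      mul_le_mul h3 h4 (abs_nonneg _) (by positivity)
    linarith
  · subst h2
    have := (hdiag i).1
    linarith
  · have h3 : L i j = 0 := by
      rcases lt_or_gt_of_ne h2 with h | h
      · exact hL.lower i j h
      · exact hLH i j h fun h' => h1 ⟨h, h'⟩
    rw [h3, sub_zero, abs_zero]
    positivity

end StepOne

/-! ### Step II -/

section StepTwo

variable {p : ℕ} {G : SimpleGraph (Fin p)} {M L Ω : Matrix (Fin p) (Fin p) ℝ}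

/-- A lower triangular matrix with at most two nonzero subdiagonals. -/
def IsLowerBand (F : Matrix (Fin p) (Fin p) ℝ) : Prop :=
  ∀ i j : Fin p, F i j ≠ 0 → j ≤ i ∧ (i : ℕ) ≤ j + 2

lemma IsLowerBand.eq_zero {F : Matrix (Fin p) (Fin p) ℝ} (hF : IsLowerBand F) {i j : Fin p}
    (h : (j : ℕ) + 2 < i) : F i j = 0 := by
  by_contra hne
  have := (hF i j hne).2
  omega

lemma stepTwo_eq_self {i j : Fin p} (h : ¬ (j < i ∧ ¬ G.Adj i j)) :
    stepTwo G M i j = M i j := by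
  rw [stepTwo, dif_neg h]

lemma stepTwo_diag (i : Fin p) : stepTwo G M i i = M i i :=
  stepTwo_eq_self fun h => lt_irrefl _ h.1

lemma stepTwo_of_not_adj {i j : Fin p} (hij : j < i) (h : ¬ G.Adj i j) :
    stepTwo G M i j =
      -(∑ k : {k : Fin p // k < j}, stepTwo G M i k.1 * stepTwo G M j k.1) / M j j := by
  rw [stepTwo, dif_pos ⟨hij, h⟩, stepTwo_diag]

lemma isLowerBand_stepTwo (hG : ∀ i j, G.Adj i j → (i : ℕ) ≤ j + 2) (hM : IsLowerBand M) :
    IsLowerBand (Matrix.of (stepTwo G M)) := by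
  have key : ∀ m : ℕ, ∀ i j : Fin p, (j : ℕ) = m → (j : ℕ) + 2 < i → stepTwo G M i j = 0 := by
    intro m
    induction m using Nat.strong_induction_on with
    | _ m ih =>
      intro i j hj hij
      rw [stepTwo_of_not_adj (by rw [Fin.lt_def]; omega) fun h => by
        have := hG i j h
        omega]
      rw [Finset.sum_eq_zero, neg_zero, zero_div]
      rintro ⟨k, hk⟩ -
      rw [Fin.lt_def] at hk
      rw [ih k (by omega) i k rfl (by omega), zero_mul]
  intro i j hne
  rw [Matrix.of_apply] at hne
  constructor
  · by_contra h
    rw [stepTwo_eq_self fun h' => h h'.1.le] at hne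
    exact h (hM i j hne).1
  · by_contra h
    exact hne (key j i j rfl (by omega))

/-- In both cases every `k < j` lies more than two places to the left of `i`. So a non-edge on the
second subdiagonal is completed by `0`. -/
lemma IsLowerBand.sum_eq_zero {F : Matrix (Fin p) (Fin p) ℝ} (hF : IsLowerBand F) {i j : Fin p}
    (h : (j : ℕ) + 2 = i ∨ (j : ℕ) = 0) : ∑ k : {k : Fin p // k < j}, F i k.1 * F j k.1 = 0 := by
  apply Finset.sum_eq_zero
  rintro ⟨k, hk⟩ -
  rw [Fin.lt_def] at hk
  have h0 : F i k = 0 := hF.eq_zero (by omega)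
  simp only [h0, zero_mul]

/-- On the first subdiagonal only `k = j - 1` is within the band of row `i`, so Step II becomes a
scalar recursion from row to row. -/
lemma IsLowerBand.sum_eq_single {F : Matrix (Fin p) (Fin p) ℝ} (hF : IsLowerBand F)
    {i j k : Fin p} (hk : (k : ℕ) + 1 = j) (hj : (j : ℕ) + 1 = i) :
    ∑ k : {k : Fin p // k < j}, F i k.1 * F j k.1 = F i k * F j k := by
  have hkj : k < j := by rw [Fin.lt_def]; omega
  rw [Finset.sum_eq_single (⟨k, hkj⟩ : {k : Fin p // k < j})]
  · rintro ⟨l, hl⟩ - hne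
    rw [Fin.lt_def] at hl
    have : (l : ℕ) ≠ k := fun h => hne (Subtype.ext (Fin.ext h))
    have h0 : F i l = 0 := hF.eq_zero (by omega)
    simp only [h0, zero_mul]
  · simp

/-- Propagation of an entrywise error through the second step of CCA. -/
lemma abs_stepTwo_sub_le {lam Lam ξ η A K : ℝ} (hlam : 0 < lam) (hLam : 0 < Lam)
    (hG : ∀ i j, G.Adj i j → (i : ℕ) ≤ j + 2)
    (hΩ : Ω ∈ concentrationSet G) (hL : IsCholeskyFactor L Ω)
    (hLb : IsLowerBand L) (hMb : IsLowerBand M)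
    (hLdiag : ∀ i, lam ≤ L i i) (hLle : ∀ i j, |L i j| ≤ Lam)
    (hratio : ∀ i j : Fin p, (i : ℕ) + 2 = j → (j : ℕ) + 1 < p → |L j i| / L j j ≤ ξ)
    (hη0 : 0 ≤ η) (hη : η ≤ lam / 2) (hM : ∀ i j, |M i j - L i j| ≤ η)
    (hA : A = 2 / lam + 2 * Lam / lam ^ 2) (hK1 : 1 ≤ K * lam)
    (hηA : A * Lam * η ≤ (1 - ξ) * lam / 2) (hK2 : 2 * A * Lam ≤ (1 - ξ) * lam * K) (i j : Fin p) :
    |stepTwo G M i j - L i j| ≤ (1 + Lam * K + K * ((1 - ξ) * lam / 2) + A * Lam) * η := by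
  have hA0 : 0 < A := by rw [hA]; positivity
  have hK0 : 0 < K := by
    by_contra h
    have : K * lam ≤ 0 := mul_nonpos_of_nonpos_of_nonneg (not_lt.mp h) hlam.le
    linarith
  have hξ : 0 ≤ (1 - ξ) * lam / 2 := le_trans (by positivity) hηA
  set F : Matrix (Fin p) (Fin p) ℝ := Matrix.of (stepTwo G M) with hF
  have hFb : IsLowerBand F := isLowerBand_stepTwo hG hMb
  have hzero : ∀ {i j : Fin p}, j < i → ¬ G.Adj i j → Ω i j = 0 :=
    fun hij h => hΩ.2 _ _ hij.ne' h
  have hFeq : ∀ {i j : Fin p}, j < i → ¬ G.Adj i j →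
      F i j = -(∑ k : {k : Fin p // k < j}, F i k.1 * F j k.1) / M j j :=
    fun hij h => stepTwo_of_not_adj hij h
  have hF1 : ∀ {i j : Fin p}, ¬ (j < i ∧ ¬ G.Adj i j) → |F i j - L i j| ≤ η := by
    intro i j h
    rw [show F i j = M i j from stepTwo_eq_self h]
    exact hM i j
  have hF2 : ∀ {i k : Fin p}, (k : ℕ) + 2 = i → |F i k - L i k| ≤ η := by
    intro i k hik
    by_cases h : G.Adj i k
    · exact hF1 fun h' => h'.2 h
    · have hki : k < i := by rw [Fin.lt_def]; omega
      rw [hFeq hki h, hL.apply_eq_of_eq_zero (hzero hki h), hFb.sum_eq_zero (Or.inl hik),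
        hLb.sum_eq_zero (Or.inl hik)]
      simpa using hη0
  have hMdiag : ∀ j, lam / 2 ≤ M j j := by
    intro j
    have h1 := (abs_le.mp (hM j j)).1
    have h2 := hLdiag j
    linarith
  -- one step of the recursion
  have hstep : ∀ {i j k : Fin p}, (k : ℕ) + 1 = j → (j : ℕ) + 1 = i → ¬ G.Adj i j →
      |F i j - L i j| ≤ (|L i k| / L j j + A * η) * |F j k - L j k| + A * η * Lam := by
    intro i j k hk hj h
    have hji : j < i := by rw [Fin.lt_def]; omega
    have hLj : 0 < L j j := hL.diag_pos j
    have hMj : 0 < M j j := lt_of_lt_of_le (by positivity) (hMdiag j)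
    -- `A` is the Lipschitz constant of the quotient: `2 / lam` comes from the numerator and `2 *
    -- Lam / lam ^ 2` from the denominator.
    have hdiff : |F i k / M j j - L i k / L j j| ≤ A * η := by
      have h1 : F i k / M j j - L i k / L j j
          = (F i k - L i k) * (1 / M j j)
            - L i k * (M j j - L j j) * (1 / M j j) * (1 / L j j) := by
        field_simp
        ring
      have h2 : 1 / M j j ≤ 2 / lam := by
        rw [div_le_div_iff₀ hMj hlam]
        linarith [hMdiag j]
      have h3 : 1 / L j j ≤ 1 / lam := one_div_le_one_div_of_le hlam (hLdiag j)
      rw [h1]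
      refine (abs_sub _ _).trans ?_
      rw [abs_mul, abs_mul, abs_mul, abs_mul, abs_of_pos (one_div_pos.mpr hMj),
        abs_of_pos (one_div_pos.mpr hLj)]
      have h4 : |F i k - L i k| * (1 / M j j) ≤ η * (2 / lam) := by
        gcongr
        exact hF2 (by omega)
      have h5 : |L i k| * |M j j - L j j| * (1 / M j j) * (1 / L j j)
          ≤ Lam * η * (2 / lam) * (1 / lam) := by
        gcongr
        · exact hLle i k
        · exact hM j j
      refine (add_le_add h4 h5).trans (le_of_eq ?_)
      rw [hA]
      field_simp
    have h1 : F i j - L i j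
        = -((L i k / L j j + (F i k / M j j - L i k / L j j)) * (F j k - L j k)
          + (F i k / M j j - L i k / L j j) * L j k) := by
      rw [hFeq hji h, hL.apply_eq_of_eq_zero (hzero hji h), hFb.sum_eq_single hk hj,
        hLb.sum_eq_single hk hj]
      ring
    rw [h1, abs_neg]
    refine (abs_add_le _ _).trans ?_
    rw [abs_mul, abs_mul]
    gcongr
    · refine (abs_add_le _ _).trans ?_
      rw [abs_div, abs_of_pos hLj]
      gcongr
    · exact hLle j k
  have hfirst : ∀ {i j : Fin p}, (j : ℕ) = 0 → (j : ℕ) + 1 = i → |F i j - L i j| ≤ η := by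
    intro i j hj hi
    by_cases h : G.Adj i j
    · exact hF1 fun h' => h'.2 h
    · have hji : j < i := by rw [Fin.lt_def]; omega
      rw [hFeq hji h, hL.apply_eq_of_eq_zero (hzero hji h), hFb.sum_eq_zero (Or.inr hj),
        hLb.sum_eq_zero (Or.inr hj)]
      simpa using hη0
  have hηK : ∀ i, η ≤ K * η * L i i := by
    intro i
    calc η = 1 * η := (one_mul _).symm
      _ ≤ K * lam * η := by gcongr
      _ = K * η * lam := by ring
      _ ≤ K * η * L i i := by gcongr; exact hLdiag i
  -- The recursion multiplies the error by `|L i k| / L j j`, which need not be below one; the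
  -- hypothesis controls `|L i k| / L i i`. Measuring the error in row `i` in units of `L i i`
  -- exchanges one denominator for the other and makes the step a contraction by `ξ`. The slack `(1
  -- - ξ) * lam` is split evenly between the perturbation of the factor and the source term.
  have hrec : ∀ m : ℕ, ∀ i j : Fin p, (j : ℕ) = m → (j : ℕ) + 1 = i → (i : ℕ) + 1 < p →
      |F i j - L i j| ≤ K * η * L i i := by
    intro m
    induction m with
    | zero => exact fun i j hj hi _ => (hfirst hj hi).trans (hηK i)
    | succ m ih =>
      intro i j hj hi hip
      by_cases h : G.Adj i j
      · exact (hF1 fun h' => h'.2 h).trans (hηK i)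
      · have hk : m < p := by omega
        have h1 := hstep (k := ⟨m, hk⟩) hj.symm hi h
        have h2 := ih j ⟨m, hk⟩ rfl hj.symm (by omega)
        have hLj : 0 < L j j := hL.diag_pos j
        have hLi : 0 < L i i := hL.diag_pos i
        have h3 := hratio ⟨m, hk⟩ i (by simp; omega) hip
        rw [div_le_iff₀ hLi] at h3
        have h4 : L j j ≤ Lam := (le_abs_self _).trans (hLle j j)
        calc |F i j - L i j|
            ≤ (|L i ⟨m, hk⟩| / L j j + A * η) * (K * η * L j j) + A * η * Lam := by
              refine h1.trans ?_
              gcongr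
          _ = |L i ⟨m, hk⟩| * (K * η) + A * η * (K * η * L j j) + A * η * Lam := by
              field_simp
          _ ≤ ξ * L i i * (K * η) + A * η * (K * η * Lam) + A * η * Lam := by gcongr
          _ = ξ * L i i * (K * η) + K * η * (A * Lam * η) + (2 * A * Lam) * η / 2 := by ring
          _ ≤ ξ * L i i * (K * η) + K * η * ((1 - ξ) * lam / 2)
                + ((1 - ξ) * lam * K) * η / 2 := by gcongr
          _ = ξ * L i i * (K * η) + 2 * (K * η) * ((1 - ξ) * lam / 2) := by ring
          _ ≤ K * η * L i i := by
              have h5 : 0 ≤ 1 - ξ := by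
                by_contra hneg
                have : (1 - ξ) * lam < 0 := mul_neg_of_neg_of_pos (not_le.mp hneg) hlam
                linarith
              have h6 : (K * η) * ((1 - ξ) * lam) ≤ (K * η) * ((1 - ξ) * L i i) := by
                gcongr
                exact hLdiag i
              linarith
  have hKL : ∀ i, K * η * L i i ≤ Lam * K * η := by
    intro i
    calc K * η * L i i ≤ K * η * Lam := by gcongr; exact (le_abs_self _).trans (hLle i i)
      _ = _ := by ring
  have hpos1 : 0 ≤ Lam * K * η := by positivity
  have hpos2 : 0 ≤ K * ((1 - ξ) * lam / 2) * η := by positivity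
  have hpos3 : 0 ≤ A * Lam * η := by positivity
  change |F i j - L i j| ≤ _
  by_cases hcase : (j : ℕ) + 1 = i
  · rcases Nat.eq_zero_or_pos (j : ℕ) with hj | hj
    · have := hfirst hj hcase
      linarith
    by_cases h : G.Adj i j
    · have := hF1 (i := i) (j := j) fun h' => h'.2 h
      linarith
    -- The ratio hypothesis stops before the last row. There the recursion is applied once more
    -- without contraction, at the price of the factor `Lam`.
    by_cases hip : (i : ℕ) + 1 < p
    · have := (hrec j i j rfl hcase hip).trans (hKL i)
      linarith
    have hk : (j : ℕ) - 1 < p := by omega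
    have hkj : ((⟨(j : ℕ) - 1, hk⟩ : Fin p) : ℕ) + 1 = j := by simp; omega
    have h1 := hstep hkj hcase h
    have h2 := hrec _ j _ rfl hkj (by omega)
    have hLj : 0 < L j j := hL.diag_pos j
    have h4 : L j j ≤ Lam := (le_abs_self _).trans (hLle j j)
    have h5 := hLle i ⟨(j : ℕ) - 1, hk⟩
    have h6 : |F i j - L i j| ≤ Lam * K * η + K * ((1 - ξ) * lam / 2) * η + A * Lam * η := by
      calc |F i j - L i j|
          ≤ (|L i ⟨(j : ℕ) - 1, hk⟩| / L j j + A * η) * (K * η * L j j) + A * η * Lam := by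
            refine h1.trans ?_
            gcongr
        _ = |L i ⟨(j : ℕ) - 1, hk⟩| * (K * η) + A * η * (K * η * L j j) + A * η * Lam := by
            field_simp
        _ ≤ Lam * (K * η) + A * η * (K * η * Lam) + A * η * Lam := by gcongr
        _ = Lam * (K * η) + K * η * (A * Lam * η) + A * η * Lam := by ring
        _ ≤ Lam * (K * η) + K * η * ((1 - ξ) * lam / 2) + A * η * Lam := by gcongr
        _ = _ := by ring
    linarith
  · have h1 : |F i j - L i j| ≤ η := by
      by_cases h0 : j ≤ i ∧ (i : ℕ) ≤ j + 2
      · by_cases h2 : (j : ℕ) + 2 = i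
        · exact hF2 h2
        · refine hF1 fun h' => ?_
          have := h'.1
          rw [Fin.lt_def] at this
          omega
      · have h2 : F i j = 0 := by
          by_contra h; exact h0 (hFb i j h)
        have h3 : L i j = 0 := by
          by_contra h; exact h0 (hLb i j h)
        rw [h2, h3, sub_zero, abs_zero]
        exact hη0
    linarith

/-- The CCA estimator is Lipschitz at the true covariance matrix, entry by entry, and both it and
the true Cholesky factor are banded. -/
theorem exists_ccaL_bound {δ ξ : ℝ} (hδ : 0 < δ) (hξ : ξ < 1) : ∃ C ε₀ : ℝ, 0 < C ∧ 0 < ε₀ ∧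
    ∀ (p : ℕ) (G : SimpleGraph (Fin p)) (L Ω S : Matrix (Fin p) (Fin p) ℝ) (ε : ℝ),
      (∀ i j, G.Adj i j → (i : ℕ) ≤ j + 2) → Ω ∈ concentrationSet G →
      (∀ t ∈ spectrum ℝ Ω, δ ≤ t ∧ t ≤ δ⁻¹) → IsCholeskyFactor L Ω →
      (∀ i j : Fin p, (i : ℕ) + 2 = j → (j : ℕ) + 1 < p → |L j i| / L j j ≤ ξ) →
      0 ≤ ε → ε ≤ ε₀ → (∀ i j, |S i j - Ω⁻¹ i j| ≤ ε) →
      (∀ i j, |ccaL G S i j - L i j| ≤ C * ε) ∧ IsLowerBand (ccaL G S) ∧ IsLowerBand L ∧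
        ∀ i j, |L i j| ≤ √δ⁻¹ := by
  obtain ⟨C₁, ε₁, hC₁, hε₁, H₁⟩ := exists_stepOne_bound hδ
  set lam : ℝ := √δ with hlam
  set Lam : ℝ := √δ⁻¹ with hLam
  have hlam0 : 0 < lam := Real.sqrt_pos.mpr hδ
  have hLam0 : 0 < Lam := Real.sqrt_pos.mpr (inv_pos.mpr hδ)
  have hξ' : 0 < 1 - ξ := by linarith
  set A : ℝ := 2 / lam + 2 * Lam / lam ^ 2 with hA
  have hA0 : 0 < A := by positivity
  -- The first summand covers rows where the recursion starts afresh with error `η`; the second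
  -- absorbs the source term `A * η * Lam` of each step.
  set K : ℝ := 1 / lam + 2 * A * Lam / ((1 - ξ) * lam) with hK
  have hK0 : 0 < K := by positivity
  refine ⟨(1 + Lam * K + K * ((1 - ξ) * lam / 2) + A * Lam) * C₁,
    min ε₁ (min (lam / 2 / C₁) ((1 - ξ) * lam / 2 / (A * Lam * C₁))), by positivity,
    by positivity, ?_⟩
  intro p G L Ω S ε hG hΩ hspec hL hratio hε0 hε hS
  have hfill : ∀ i j, (filledGraph G).Adj i j → (i : ℕ) ≤ j + 2 :=
    fun i j h => FillAdj.le_add_two hG h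
  have hsupp : ∀ i j, j < i → ¬ (filledGraph G).Adj i j → L i j = 0 :=
    fun i j hij h => hL.eq_zero_of_not_fillAdj hΩ j i j rfl hij h
  have h1 := H₁ p (filledGraph G) L Ω S ε hfill hΩ.1 hspec hL hsupp hε0
    (hε.trans (min_le_left _ _)) hS
  have hε2 : ε ≤ lam / 2 / C₁ := hε.trans ((min_le_right _ _).trans (min_le_left _ _))
  have hε3 : ε ≤ (1 - ξ) * lam / 2 / (A * Lam * C₁) :=
    hε.trans ((min_le_right _ _).trans (min_le_right _ _))
  rw [le_div_iff₀ (by positivity)] at hε2 hε3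
  have hLb : IsLowerBand L := by
    intro i j hne
    constructor
    · by_contra h
      exact hne (hL.lower i j (not_le.mp h))
    · by_contra h
      exact hne (hsupp i j (by rw [Fin.lt_def]; omega) fun h' => h (hfill i j h'))
  have hMb : IsLowerBand (stepOne (filledGraph G) S) := by
    intro i j hne
    unfold stepOne at hne
    split_ifs at hne with h2 h3
    · exact ⟨h2.1.le, hfill i j h2.2⟩
    · subst h3
      exact ⟨le_rfl, by omega⟩
    · exact absurd rfl hne
  have hLle : ∀ i j, |L i j| ≤ Lam := by
    intro i j
    apply Real.abs_le_sqrt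
    exact (hL.sq_le i j).trans
      (apply_self_le_of_spectrum hΩ.1.isHermitian (fun t ht => (hspec t ht).2) i)
  have hLdiag : ∀ i, lam ≤ L i i := by
    intro i
    apply Real.sqrt_le_iff.mpr ⟨(hL.diag_pos i).le, ?_⟩
    have h2 := (hL.one_div_sq_le i).trans
      (apply_self_le_of_spectrum hΩ.1.inv.isHermitian
        (fun t ht => (spectrum_inv_bounds hΩ.1 hδ hspec t ht).2) i)
    rw [one_div] at h2
    exact (inv_le_inv₀ (pow_pos (hL.diag_pos i) 2) hδ).mp h2
  refine ⟨fun i j => ?_, isLowerBand_stepTwo hG hMb, hLb, hLle⟩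
  have hK1 : 1 ≤ K * lam := by
    have : K * lam = 1 + 2 * A * Lam / ((1 - ξ) * lam) * lam := by
      rw [hK, add_mul, one_div_mul_cancel hlam0.ne']
    have h2 : 0 ≤ 2 * A * Lam / ((1 - ξ) * lam) * lam := by positivity
    linarith
  have hK2 : 2 * A * Lam ≤ (1 - ξ) * lam * K := by
    have : (1 - ξ) * lam * K = (1 - ξ) + 2 * A * Lam := by
      rw [hK]; field_simp
    linarith
  refine (abs_stepTwo_sub_le hlam0 hLam0 hG hΩ hL hLb hMb hLdiag hLle hratio
    (by positivity : 0 ≤ C₁ * ε) (by linarith) h1 hA hK1 (by linarith) hK2 i j).trans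
    (le_of_eq (by ring))

end StepTwo

/-! ### Frobenius norms of banded matrices -/

lemma frobenius_norm_le_of_band {p : ℕ} {M : Matrix (Fin p) (Fin p) ℝ} {B : ℝ} (hB : 0 ≤ B)
    (hM : ∀ i j, |M i j| ≤ B)
    (hband : ∀ i j : Fin p, M i j ≠ 0 → (i : ℕ) ≤ j + 2 ∧ (j : ℕ) ≤ i + 2) :
    ‖M‖ ≤ √(5 * p) * B := by
  rw [Matrix.frobenius_norm_def, ← Real.sqrt_eq_rpow]
  have hrow : ∀ i, ∑ j, ‖M i j‖ ^ (2 : ℝ) ≤ 5 * B ^ 2 := by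
    intro i
    set s : Finset (Fin p) := Finset.univ.filter fun j => (i : ℕ) ≤ j + 2 ∧ (j : ℕ) ≤ i + 2
    have hs : s.card ≤ 5 := by
      have h1 : s.card ≤ (Finset.Icc ((i : ℕ) - 2) (i + 2)).card := by
        apply Finset.card_le_card_of_injOn (fun j : Fin p => (j : ℕ))
        · intro j hj
          simp only [s, Finset.coe_filter, Finset.mem_univ, true_and, Set.mem_ofPred_eq] at hj
          simp only [Finset.coe_Icc, Set.mem_Icc]
          omega
        · exact Fin.val_injective.injOn
      rw [Nat.card_Icc] at h1
      omega
    calc ∑ j, ‖M i j‖ ^ (2 : ℝ) = ∑ j ∈ s, ‖M i j‖ ^ (2 : ℝ) := by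
          symm
          apply Finset.sum_subset (Finset.subset_univ _)
          intro j _ hj
          have : M i j = 0 := by
            by_contra h
            exact hj (by simpa [s] using hband i j h)
          simp [this]
      _ ≤ ∑ _j ∈ s, B ^ 2 := by
          refine Finset.sum_le_sum fun j _ => ?_
          rw [Real.rpow_two, Real.norm_eq_abs]
          exact pow_le_pow_left₀ (abs_nonneg _) (hM i j) 2
      _ = s.card * B ^ 2 := by simp
      _ ≤ 5 * B ^ 2 := by
          gcongr
          exact_mod_cast hs
  calc √(∑ i, ∑ j, ‖M i j‖ ^ (2 : ℝ)) ≤ √(∑ _i : Fin p, 5 * B ^ 2) :=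
        Real.sqrt_le_sqrt (Finset.sum_le_sum fun i _ => hrow i)
    _ = √(5 * p * B ^ 2) := by
        congr 1
        simp
        ring
    _ = √(5 * p) * B := by
        rw [Real.sqrt_mul (by positivity), Real.sqrt_sq hB]

/-- A row of either factor has at most three nonzero entries, so passing from `L` to `L Lᵀ` costs no
factor of `p`. -/
lemma IsLowerBand.abs_mul_transpose_sub_le {p : ℕ} {F L : Matrix (Fin p) (Fin p) ℝ}
    (hF : IsLowerBand F) (hL : IsLowerBand L) {B Lam : ℝ} (hB : 0 ≤ B) (hLam : 0 ≤ Lam)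
    (hLle : ∀ i j, |L i j| ≤ Lam) (h : ∀ i j, |F i j - L i j| ≤ B) (i j : Fin p) :
    |(F * Fᵀ - L * Lᵀ) i j| ≤ 3 * (B * (B + 2 * Lam)) := by
  have h1 : (F * Fᵀ - L * Lᵀ) i j = ∑ k, (F i k * F j k - L i k * L j k) := by
    simp [Matrix.mul_apply, Finset.sum_sub_distrib]
  set s : Finset (Fin p) := Finset.univ.filter fun k => k ≤ i ∧ (i : ℕ) ≤ k + 2
  have hs : s.card ≤ 3 := by
    have h1 : s.card ≤ (Finset.Icc ((i : ℕ) - 2) i).card := by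
      apply Finset.card_le_card_of_injOn (fun j : Fin p => (j : ℕ))
      · intro k hk
        simp only [s, Finset.coe_filter, Finset.mem_univ, true_and, Set.mem_ofPred_eq,
          Fin.le_def] at hk
        simp only [Finset.coe_Icc, Set.mem_Icc]
        omega
      · exact Fin.val_injective.injOn
    rw [Nat.card_Icc] at h1
    omega
  have h2 : ∑ k, (F i k * F j k - L i k * L j k) = ∑ k ∈ s, (F i k * F j k - L i k * L j k) := by
    symm
    apply Finset.sum_subset (Finset.subset_univ _)
    intro k _ hk
    have hk' : ¬ (k ≤ i ∧ (i : ℕ) ≤ k + 2) := by simpa [s] using hk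
    have h3 : F i k = 0 := by by_contra h; exact hk' (hF i k h)
    have h4 : L i k = 0 := by by_contra h; exact hk' (hL i k h)
    rw [h3, h4]; ring
  rw [h1, h2]
  calc |∑ k ∈ s, (F i k * F j k - L i k * L j k)|
      ≤ ∑ k ∈ s, |F i k * F j k - L i k * L j k| := Finset.abs_sum_le_sum_abs _ _
    _ ≤ ∑ _k ∈ s, B * (B + 2 * Lam) := by
        refine Finset.sum_le_sum fun k _ => ?_
        have h3 : F i k * F j k - L i k * L j k = (F i k - L i k) * (F j k - L j k)
            + (F i k - L i k) * L j k + L i k * (F j k - L j k) := by ring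
        rw [h3]
        refine (abs_add_three _ _ _).trans ?_
        rw [abs_mul, abs_mul, abs_mul]
        have h4 := mul_le_mul (h i k) (h j k) (abs_nonneg _) hB
        have h5 := mul_le_mul (h i k) (hLle j k) (abs_nonneg _) hB
        have h6 := mul_le_mul (hLle i k) (h j k) (abs_nonneg _) hLam
        linarith
    _ = s.card * (B * (B + 2 * Lam)) := by simp
    _ ≤ 3 * (B * (B + 2 * Lam)) := by
        gcongr
        exact_mod_cast hs

lemma IsLowerBand.band_sub {p : ℕ} {F L : Matrix (Fin p) (Fin p) ℝ} (hF : IsLowerBand F)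
    (hL : IsLowerBand L) (i j : Fin p) (hne : (F - L) i j ≠ 0) :
    (i : ℕ) ≤ j + 2 ∧ (j : ℕ) ≤ i + 2 := by
  have h : j ≤ i ∧ (i : ℕ) ≤ j + 2 := by
    by_contra h
    have h1 : F i j = 0 := by by_contra h'; exact h (hF i j h')
    have h2 : L i j = 0 := by by_contra h'; exact h (hL i j h')
    exact hne (by rw [Matrix.sub_apply, h1, h2, sub_zero])
  rw [Fin.le_def] at h
  omega

lemma IsLowerBand.mul_transpose_band {p : ℕ} {F : Matrix (Fin p) (Fin p) ℝ} (hF : IsLowerBand F)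
    (i j : Fin p) (hne : (F * Fᵀ) i j ≠ 0) : (i : ℕ) ≤ j + 2 ∧ (j : ℕ) ≤ i + 2 := by
  rw [Matrix.mul_apply] at hne
  obtain ⟨k, -, hk⟩ := Finset.exists_ne_zero_of_sum_ne_zero hne
  rw [Matrix.transpose_apply, mul_ne_zero_iff] at hk
  have h1 := hF i k hk.1
  have h2 := hF j k hk.2
  rw [Fin.le_def] at h1 h2
  omega

/-! ### Exponential moments -/

/-- Completing the square exhibits `exp (z² / (4b))` as a Gaussian mixture of the exponentials `exp
(u z)`, whose means are controlled for sub-Gaussian `z`. -/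
lemma lintegral_exp_neg_mul_sq_add {b : ℝ} (hb : 0 < b) (z : ℝ) :
    ∫⁻ u : ℝ, ENNReal.ofReal (Real.exp (-b * u ^ 2 + u * z))
      = ENNReal.ofReal (Real.exp (z ^ 2 / (4 * b)) * √(Real.pi / b)) := by
  have h1 : ∀ u : ℝ, Real.exp (-b * u ^ 2 + u * z)
      = Real.exp (z ^ 2 / (4 * b)) * Real.exp (-b * (u - z / (2 * b)) ^ 2) := by
    intro u
    rw [← Real.exp_add]
    congr 1
    field_simp
    ring
  have h2 : Integrable fun u : ℝ => Real.exp (-b * (u - z / (2 * b)) ^ 2) :=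
    (integrable_exp_neg_mul_sq hb).comp_sub_right (z / (2 * b))
  simp_rw [h1]
  rw [← ofReal_integral_eq_lintegral_ofReal (h2.const_mul _)
    (Eventually.of_forall fun u => by positivity), integral_const_mul,
    integral_sub_right_eq_self (fun u : ℝ => Real.exp (-b * u ^ 2)), integral_gaussian]

section Moments

variable {X : Type*} [MeasurableSpace X] {P : Measure X}

/-- The square of a sub-Gaussian random variable has an exponential moment. -/
lemma exp_sq_moment_of_subgaussian [SFinite P] {Z : X → ℝ} (hZ : Measurable Z) {c : ℝ}
    (hc : 0 < c)
    (h : ∀ t : ℝ, Integrable (fun ω => Real.exp (t * Z ω)) P ∧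
      ∫ ω, Real.exp (t * Z ω) ∂P ≤ Real.exp (c * t ^ 2)) :
    Integrable (fun ω => Real.exp (Z ω ^ 2 / (8 * c))) P ∧
      ∫ ω, Real.exp (Z ω ^ 2 / (8 * c)) ∂P ≤ 2 := by
  have hmeas : Measurable fun ω => Real.exp (Z ω ^ 2 / (8 * c)) := by fun_prop
  set a : ℝ := √(Real.pi / (2 * c)) with ha
  have ha0 : 0 < a := Real.sqrt_pos.mpr (by positivity)
  -- Integrate the sub-Gaussian bound against `exp (-2c u²) du` and exchange the integrals. Half of
  -- the Gaussian weight pays for `exp (c u²)`; the ratio of the two normalisations is `√2 ≤ 2`.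
  have h1 : (∫⁻ ω, ENNReal.ofReal (Real.exp (Z ω ^ 2 / (8 * c))) ∂P) * ENNReal.ofReal a
      ≤ ENNReal.ofReal (√(Real.pi / c)) := by
    calc (∫⁻ ω, ENNReal.ofReal (Real.exp (Z ω ^ 2 / (8 * c))) ∂P) * ENNReal.ofReal a
        = ∫⁻ ω, (∫⁻ u : ℝ, ENNReal.ofReal (Real.exp (-(2 * c) * u ^ 2 + u * Z ω))) ∂P := by
          rw [← lintegral_mul_const _ hmeas.ennreal_ofReal]
          refine lintegral_congr fun ω => ?_
          rw [lintegral_exp_neg_mul_sq_add (by positivity), ENNReal.ofReal_mul (by positivity)]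
          congr 4
          ring
      _ = ∫⁻ u : ℝ, ∫⁻ ω, ENNReal.ofReal (Real.exp (-(2 * c) * u ^ 2 + u * Z ω)) ∂P := by
          apply lintegral_lintegral_swap
          apply Measurable.aemeasurable
          unfold Function.uncurry
          fun_prop
      _ ≤ ∫⁻ u : ℝ, ENNReal.ofReal (Real.exp (-c * u ^ 2 + u * 0)) := by
          refine lintegral_mono fun u => ?_
          have h2 : ∀ ω, ENNReal.ofReal (Real.exp (-(2 * c) * u ^ 2 + u * Z ω))
              = ENNReal.ofReal (Real.exp (-(2 * c) * u ^ 2) * Real.exp (u * Z ω)) := by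
            intro ω; rw [Real.exp_add]
          simp_rw [h2]
          rw [← ofReal_integral_eq_lintegral_ofReal ((h u).1.const_mul _)
            (Eventually.of_forall fun ω => by positivity), integral_const_mul]
          apply ENNReal.ofReal_le_ofReal
          calc Real.exp (-(2 * c) * u ^ 2) * ∫ ω, Real.exp (u * Z ω) ∂P
              ≤ Real.exp (-(2 * c) * u ^ 2) * Real.exp (c * u ^ 2) := by
                gcongr; exact (h u).2
            _ = Real.exp (-c * u ^ 2 + u * 0) := by
                rw [← Real.exp_add]; congr 1; ring
      _ = ENNReal.ofReal (√(Real.pi / c)) := by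
          rw [lintegral_exp_neg_mul_sq_add hc]
          simp
  have h2 : √(Real.pi / c) ≤ 2 * a := by
    rw [ha]
    apply Real.sqrt_le_iff.mpr ⟨by positivity, ?_⟩
    rw [mul_pow, Real.sq_sqrt (by positivity)]
    have : (0 : ℝ) ≤ Real.pi / c := by positivity
    have h3 : Real.pi / (2 * c) = Real.pi / c / 2 := by field_simp
    rw [h3]
    linarith
  have h3 : ∫⁻ ω, ENNReal.ofReal (Real.exp (Z ω ^ 2 / (8 * c))) ∂P ≤ ENNReal.ofReal 2 := by
    have h4 : (∫⁻ ω, ENNReal.ofReal (Real.exp (Z ω ^ 2 / (8 * c))) ∂P) * ENNReal.ofReal a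
        ≤ ENNReal.ofReal 2 * ENNReal.ofReal a := by
      rw [← ENNReal.ofReal_mul (by norm_num)]
      exact h1.trans (ENNReal.ofReal_le_ofReal h2)
    exact (ENNReal.mul_le_mul_iff_left (by simpa using ha0) ENNReal.ofReal_ne_top).mp h4
  have hint : Integrable (fun ω => Real.exp (Z ω ^ 2 / (8 * c))) P := by
    refine ⟨hmeas.aestronglyMeasurable, ?_⟩
    rw [hasFiniteIntegral_iff_ofReal (Eventually.of_forall fun ω => by positivity)]
    exact h3.trans_lt ENNReal.ofReal_lt_top
  refine ⟨hint, ?_⟩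
  rw [← ofReal_integral_eq_lintegral_ofReal hint
    (Eventually.of_forall fun ω => by positivity)] at h3
  exact (ENNReal.ofReal_le_ofReal_iff (by norm_num)).mp h3

lemma exp_le_one_add_add_sq_mul (x : ℝ) : Real.exp x ≤ 1 + x + x ^ 2 * Real.exp |x| := by
  have h0 : 1 ≤ Real.exp |x| := Real.one_le_exp (abs_nonneg x)
  by_cases hx : |x| ≤ 1
  · have h1 := (abs_le.mp (Real.abs_exp_sub_one_sub_id_le hx)).2
    have h2 : x ^ 2 * 1 ≤ x ^ 2 * Real.exp |x| := by gcongr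
    linarith
  · push Not at hx
    have h1 : Real.exp x ≤ Real.exp |x| := Real.exp_le_exp.mpr (le_abs_self x)
    have h2 : 1 ≤ x ^ 2 := by
      rw [← sq_abs]; exact one_le_pow₀ hx.le
    have h3 : (x ^ 2 - 1) * 1 ≤ (x ^ 2 - 1) * Real.exp |x| := by
      gcongr
    have h4 : 0 ≤ x ^ 2 + x := by
      have : |x| * 1 ≤ |x| * |x| := by gcongr
      have h5 := neg_abs_le x
      rw [abs_mul_abs_self] at this
      nlinarith
    linarith

/-- A centred random variable with an exponential moment is sub-exponential. -/
lemma mgf_le_of_exp_moment [IsProbabilityMeasure P] {W : X → ℝ} (hW : Measurable W) {s M : ℝ}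
    (hs : 0 < s) (hint : Integrable (fun ω => Real.exp (s * |W ω|)) P)
    (hM : ∫ ω, Real.exp (s * |W ω|) ∂P ≤ M) (hWint : Integrable W P) (hmean : ∫ ω, W ω ∂P = 0)
    {l : ℝ} (hl : |l| ≤ s / 2) :
    Integrable (fun ω => Real.exp (l * W ω)) P ∧ mgf W P l ≤ Real.exp (8 * M / s ^ 2 * l ^ 2) := by
  have hle : ∀ ω, Real.exp (l * W ω) ≤ Real.exp (s * |W ω|) := by
    intro ω
    apply Real.exp_le_exp.mpr
    calc l * W ω ≤ |l| * |W ω| := by rw [← abs_mul]; exact le_abs_self _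
      _ ≤ s * |W ω| := by gcongr; linarith
  have hi : Integrable (fun ω => Real.exp (l * W ω)) P := by
    refine hint.mono' (by fun_prop) (Eventually.of_forall fun ω => ?_)
    rw [Real.norm_eq_abs, Real.abs_exp]
    exact hle ω
  refine ⟨hi, ?_⟩
  -- Half of the exponent `s |W|` dominates `exp |l W|`, the other half dominates `W²` through `y² /
  -- 2 ≤ exp y` at `y = s |W| / 2`. The linear term will integrate to zero.
  have hpt : ∀ ω, Real.exp (l * W ω)
      ≤ 1 + l * W ω + 8 / s ^ 2 * l ^ 2 * Real.exp (s * |W ω|) := by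
    intro ω
    refine (exp_le_one_add_add_sq_mul _).trans ?_
    gcongr 1 + l * W ω + ?_
    have h1 : Real.exp |l * W ω| ≤ Real.exp (s / 2 * |W ω|) := by
      rw [abs_mul]; gcongr
    have h2 : (s / 2 * |W ω|) ^ 2 / 2 ≤ Real.exp (s / 2 * |W ω|) := by
      have h := Real.quadratic_le_exp_of_nonneg (x := s / 2 * |W ω|) (by positivity)
      have : 0 ≤ s / 2 * |W ω| := by positivity
      linarith
    have h3 : Real.exp (s * |W ω|) = Real.exp (s / 2 * |W ω|) * Real.exp (s / 2 * |W ω|) := by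
      rw [← Real.exp_add]; congr 1; ring
    have h4 : (l * W ω) ^ 2 = 8 / s ^ 2 * l ^ 2 * ((s / 2 * |W ω|) ^ 2 / 2) := by
      rw [mul_pow, mul_pow, sq_abs]; field_simp; ring
    rw [h3, h4, mul_assoc]
    gcongr
  have hlin : Integrable (fun ω => 1 + l * W ω) P := (integrable_const 1).add (hWint.const_mul l)
  calc mgf W P l = ∫ ω, Real.exp (l * W ω) ∂P := rfl
    _ ≤ ∫ ω, (1 + l * W ω + 8 / s ^ 2 * l ^ 2 * Real.exp (s * |W ω|)) ∂P :=
        integral_mono hi (hlin.add (hint.const_mul _)) hpt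
    _ = 1 + 8 / s ^ 2 * l ^ 2 * ∫ ω, Real.exp (s * |W ω|) ∂P := by
        rw [integral_add hlin (hint.const_mul _),
          integral_add (integrable_const 1) (hWint.const_mul l), integral_const_mul,
          integral_const_mul, hmean]
        simp
    _ ≤ 8 * M / s ^ 2 * l ^ 2 + 1 := by
        have : 8 / s ^ 2 * l ^ 2 * ∫ ω, Real.exp (s * |W ω|) ∂P ≤ 8 / s ^ 2 * l ^ 2 * M := by
          gcongr
        have h5 : 8 / s ^ 2 * l ^ 2 * M = 8 * M / s ^ 2 * l ^ 2 := by ring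
        linarith
    _ ≤ Real.exp (8 * M / s ^ 2 * l ^ 2) := Real.add_one_le_exp _

/-- A Bernstein inequality for sums of independent sub-exponential variables. -/
lemma measureReal_abs_sum_ge_le [IsProbabilityMeasure P] {n : ℕ} {W : Fin n → X → ℝ}
    (hW : ∀ i, Measurable (W i)) (hind : iIndepFun W P) {s M : ℝ} (hs : 0 < s) (hM0 : 0 < M)
    (hint : ∀ i, Integrable (fun ω => Real.exp (s * |W i ω|)) P)
    (hM : ∀ i, ∫ ω, Real.exp (s * |W i ω|) ∂P ≤ M) (hWint : ∀ i, Integrable (W i) P)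
    (hmean : ∀ i, ∫ ω, W i ω ∂P = 0) {t : ℝ} (ht0 : 0 ≤ t) (ht : t ≤ 8 * M / s) :
    P.real {ω | n * t ≤ |∑ i, W i ω|} ≤ 2 * Real.exp (-(n * t ^ 2 / (4 * (8 * M / s ^ 2)))) := by
  set C : ℝ := 8 * M / s ^ 2 with hC
  have hC0 : 0 < C := by positivity
  have hone : ∀ V : Fin n → X → ℝ, (∀ i, Measurable (V i)) → iIndepFun V P →
      (∀ i, Integrable (fun ω => Real.exp (s * |V i ω|)) P) →
      (∀ i, ∫ ω, Real.exp (s * |V i ω|) ∂P ≤ M) → (∀ i, Integrable (V i) P) →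
      (∀ i, ∫ ω, V i ω ∂P = 0) →
      P.real {ω | n * t ≤ (∑ i, V i) ω} ≤ Real.exp (-(n * t ^ 2 / (4 * C))) := by
    intro V hV hVind hVint hVM hVi hVmean
    -- The minimiser of the Chernoff exponent `-l t + C l²`; the restriction `t ≤ 8 * M / s` says
    -- exactly that `l ≤ s / 2`.
    set l : ℝ := t / (2 * C) with hl
    have hl0 : 0 ≤ l := by positivity
    have hls : |l| ≤ s / 2 := by
      rw [abs_of_nonneg hl0, hl, div_le_iff₀ (by positivity)]
      refine ht.trans (le_of_eq ?_)
      rw [hC]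
      field_simp
    have hb := fun i => mgf_le_of_exp_moment (hV i) hs (hVint i) (hVM i) (hVi i) (hVmean i) hls
    refine (measure_ge_le_exp_mul_mgf (n * t) hl0
      (hVind.integrable_exp_mul_sum hV fun i _ => (hb i).1)).trans ?_
    rw [hVind.mgf_sum hV]
    calc Real.exp (-l * (n * t)) * ∏ i, mgf (V i) P l
        ≤ Real.exp (-l * (n * t)) * ∏ _i : Fin n, Real.exp (C * l ^ 2) := by
          gcongr with i
          · exact fun i _ => mgf_nonneg
          · exact (hb i).2
      _ = Real.exp (-(n * t ^ 2 / (4 * C))) := by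
          rw [Finset.prod_const, Finset.card_univ, Fintype.card_fin, ← Real.exp_nat_mul,
            ← Real.exp_add]
          congr 1
          rw [hl]
          field_simp
          ring
  have h1 := hone W hW hind hint hM hWint hmean
  have h2 := hone (fun i ω => -W i ω) (fun i => (hW i).neg)
    (hind.comp (fun _ x => -x) fun _ => measurable_neg)
    (fun i => by simpa using hint i) (fun i => by simpa using hM i) (fun i => (hWint i).neg)
    (fun i => by rw [integral_neg, hmean i, neg_zero])
  have hsub : {ω | n * t ≤ |∑ i, W i ω|}
      ⊆ {ω | n * t ≤ (∑ i, W i) ω} ∪ {ω | n * t ≤ (∑ i, fun ω => -W i ω) ω} := by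
    intro ω hω
    have hω' : n * t ≤ |∑ i, W i ω| := hω
    rcases le_abs.mp hω' with h | h
    · left
      simpa [Finset.sum_apply] using h
    · right
      simpa [Finset.sum_apply] using h
  calc _ ≤ P.real ({ω | n * t ≤ (∑ i, W i) ω} ∪ {ω | n * t ≤ (∑ i, fun ω => -W i ω) ω}) :=
        measureReal_mono hsub
    _ ≤ _ := measureReal_union_le _ _
    _ ≤ _ := by linarith

/-- The centred product of two sub-Gaussian variables has an exponential moment. -/
lemma exp_moment_centred_mul [IsProbabilityMeasure P] {U V : X → ℝ} (hU : Measurable U)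
    (hV : Measurable V) {s m : ℝ} (hs : 0 < s)
    (hUi : Integrable (fun ω => Real.exp (s * U ω ^ 2)) P)
    (hVi : Integrable (fun ω => Real.exp (s * V ω ^ 2)) P)
    (hUM : ∫ ω, Real.exp (s * U ω ^ 2) ∂P ≤ 2) (hVM : ∫ ω, Real.exp (s * V ω ^ 2) ∂P ≤ 2)
    (hm : ∫ ω, U ω * V ω ∂P = m) :
    Integrable (fun ω => U ω * V ω) P ∧
    Integrable (fun ω => Real.exp (s * |U ω * V ω - m|)) P ∧
      ∫ ω, Real.exp (s * |U ω * V ω - m|) ∂P ≤ 2 * Real.exp 2 := by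
  have hpt : ∀ ω, Real.exp (s * |U ω * V ω|)
      ≤ (Real.exp (s * U ω ^ 2) + Real.exp (s * V ω ^ 2)) / 2 := by
    intro ω
    have h1 : Real.exp (s * |U ω * V ω|)
        ≤ Real.exp (s * U ω ^ 2 / 2) * Real.exp (s * V ω ^ 2 / 2) := by
      rw [← Real.exp_add]
      apply Real.exp_le_exp.mpr
      have h2 : |U ω * V ω| ≤ (U ω ^ 2 + V ω ^ 2) / 2 := by
        rw [abs_mul, ← sq_abs (U ω), ← sq_abs (V ω)]
        nlinarith [sq_nonneg (|U ω| - |V ω|)]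
      calc s * |U ω * V ω| ≤ s * ((U ω ^ 2 + V ω ^ 2) / 2) := by gcongr
        _ = _ := by ring
    have h3 : ∀ x : ℝ, Real.exp x = Real.exp (x / 2) ^ 2 := by
      intro x
      rw [← Real.exp_nat_mul]; congr 1; push_cast; ring
    rw [h3 (s * U ω ^ 2), h3 (s * V ω ^ 2)]
    nlinarith [sq_nonneg (Real.exp (s * U ω ^ 2 / 2) - Real.exp (s * V ω ^ 2 / 2))]
  have hi : Integrable (fun ω => Real.exp (s * |U ω * V ω|)) P := by
    refine ((hUi.add hVi).div_const 2).mono' (by fun_prop) (Eventually.of_forall fun ω => ?_)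
    rw [Real.norm_eq_abs, Real.abs_exp]
    exact hpt ω
  have hb : ∫ ω, Real.exp (s * |U ω * V ω|) ∂P ≤ 2 := by
    refine (integral_mono hi ((hUi.add hVi).div_const 2) hpt).trans ?_
    simp only [Pi.add_apply]
    rw [integral_div, integral_add hUi hVi]
    linarith
  have hlin : ∀ ω, s * |U ω * V ω| ≤ Real.exp (s * |U ω * V ω|) :=
    fun ω => by linarith [Real.add_one_le_exp (s * |U ω * V ω|)]
  have hUV : Integrable (fun ω => U ω * V ω) P := by
    refine (hi.const_mul s⁻¹).mono' (by fun_prop) (Eventually.of_forall fun ω => ?_)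
    rw [Real.norm_eq_abs, ← div_eq_inv_mul, le_div_iff₀' hs]
    exact hlin ω
  -- From `x ≤ exp x`: the exponential moment bounds the mean as well, so centring costs at most a
  -- factor `exp 2`.
  have hmb : s * |m| ≤ 2 := by
    calc s * |m| ≤ s * ∫ ω, |U ω * V ω| ∂P := by
          gcongr
          rw [← hm]
          exact abs_integral_le_integral_abs
      _ = ∫ ω, s * |U ω * V ω| ∂P := (integral_const_mul _ _).symm
      _ ≤ ∫ ω, Real.exp (s * |U ω * V ω|) ∂P := integral_mono (hUV.abs.const_mul s) hi hlin
      _ ≤ 2 := hb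
  have hpt2 : ∀ ω, Real.exp (s * |U ω * V ω - m|) ≤ Real.exp 2 * Real.exp (s * |U ω * V ω|) := by
    intro ω
    rw [← Real.exp_add]
    apply Real.exp_le_exp.mpr
    calc s * |U ω * V ω - m| ≤ s * (|U ω * V ω| + |m|) := by gcongr; exact abs_sub _ _
      _ ≤ _ := by linarith
  have hi2 : Integrable (fun ω => Real.exp (s * |U ω * V ω - m|)) P := by
    refine (hi.const_mul (Real.exp 2)).mono' (by fun_prop) (Eventually.of_forall fun ω => ?_)
    rw [Real.norm_eq_abs, Real.abs_exp]
    exact hpt2 ω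
  refine ⟨hUV, hi2, ?_⟩
  refine (integral_mono hi2 (hi.const_mul _) hpt2).trans ?_
  rw [integral_const_mul]
  have : Real.exp 2 * ∫ ω, Real.exp (s * |U ω * V ω|) ∂P ≤ Real.exp 2 * 2 := by gcongr
  linarith

/-- Concentration of the entries of the sample covariance matrix of sub-Gaussian vectors. -/
theorem exists_sampleCov_tail {c : ℝ} (hc : 0 < c) : ∃ C t₀ : ℝ, 0 < C ∧ 0 < t₀ ∧
    ∀ {X : Type*} [MeasurableSpace X] (P : Measure X) [IsProbabilityMeasure P] {n p : ℕ}
      (Y : Fin n → X → Fin p → ℝ) (Ω : Matrix (Fin p) (Fin p) ℝ), IsIIDSample P Y Ω → 0 < n →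
      (∀ (i : Fin n) (x : Fin p → ℝ), Integrable (fun ω => Real.exp (x ⬝ᵥ Y i ω)) P ∧
        ∫ ω, Real.exp (x ⬝ᵥ Y i ω) ∂P ≤ Real.exp (c * (x ⬝ᵥ x))) →
      ∀ a b t, 0 ≤ t → t ≤ t₀ →
        P.real {ω | t ≤ |sampleCov (fun i => Y i ω) a b - Ω⁻¹ a b|}
          ≤ 2 * Real.exp (-(n * t ^ 2 / (4 * C))) := by
  set s : ℝ := 1 / (8 * c) with hs
  have hs0 : 0 < s := by positivity
  set M : ℝ := 2 * Real.exp 2 with hM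
  have hM0 : 0 < M := by positivity
  refine ⟨8 * M / s ^ 2, 8 * M / s, by positivity, by positivity, ?_⟩
  intro X _ P _ n p Y Ω hY hn hA2 a b t ht0 ht
  have hmeas : ∀ i a, Measurable fun ω => Y i ω a := fun i a =>
    (measurable_pi_apply a).comp (hY.measurable i)
  have hsq : ∀ i a, Integrable (fun ω => Real.exp (s * Y i ω a ^ 2)) P ∧
      ∫ ω, Real.exp (s * Y i ω a ^ 2) ∂P ≤ 2 := by
    intro i a
    have h1 := exp_sq_moment_of_subgaussian (P := P) (hmeas i a) hc fun t => by
      -- Vectors along one coordinate axis suffice: only the marginals need to be sub-Gaussian,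
      -- since products are handled by the arithmetic-geometric mean inequality.
      have := hA2 i (Pi.single a t)
      simpa [single_dotProduct, ← sq] using this
    have h2 : ∀ ω, Y i ω a ^ 2 / (8 * c) = s * Y i ω a ^ 2 := fun ω => by
      rw [hs]; ring
    simpa only [h2] using h1
  have hmom := fun i => exp_moment_centred_mul (hmeas i a) (hmeas i b) hs0 (hsq i a).1
    (hsq i b).1 (hsq i a).2 (hsq i b).2 (hY.cov i a b)
  have hind : iIndepFun (fun i ω => Y i ω a * Y i ω b - Ω⁻¹ a b) P :=
    hY.indep.comp (fun _ y => y a * y b - Ω⁻¹ a b) fun _ => by fun_prop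
  have hWmeas : ∀ i, Measurable fun ω => Y i ω a * Y i ω b - Ω⁻¹ a b :=
    fun i => ((hmeas i a).mul (hmeas i b)).sub_const _
  have h1 := measureReal_abs_sum_ge_le hWmeas hind hs0 hM0 (fun i => (hmom i).2.1)
    (fun i => (hmom i).2.2) (fun i => (hmom i).1.sub (integrable_const _))
    (fun i => by
      rw [integral_sub (hmom i).1 (integrable_const _), hY.cov i a b]
      simp) ht0 ht
  refine le_trans (le_of_eq ?_) h1
  congr 1
  ext ω
  have hn' : (0 : ℝ) < n := by exact_mod_cast hn
  have h2 : sampleCov (fun i => Y i ω) a b - Ω⁻¹ a b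
      = (∑ i, (Y i ω a * Y i ω b - Ω⁻¹ a b)) / n := by
    rw [Finset.sum_sub_distrib, sampleCov]
    simp
    field_simp
  simp only [Set.mem_ofPred_eq]
  rw [h2, abs_div, abs_of_pos hn', le_div_iff₀' hn']

end Moments

/-- All entries of the sample covariance matrix are simultaneously close to those of the
covariance matrix. -/
lemma measureReal_compl_sampleCov_close_le {X : Type*} [MeasurableSpace X] {P : Measure X}
    [IsProbabilityMeasure P] {n p : ℕ} {Y : Fin n → X → Fin p → ℝ}
    {A : Matrix (Fin p) (Fin p) ℝ} {t q : ℝ}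
    (h : ∀ a b, P.real {ω | t ≤ |sampleCov (fun i => Y i ω) a b - A a b|} ≤ q) :
    P.real {ω | ∀ a b, |sampleCov (fun i => Y i ω) a b - A a b| < t}ᶜ ≤ p ^ 2 * q := by
  have hsub : {ω | ∀ a b, |sampleCov (fun i => Y i ω) a b - A a b| < t}ᶜ
      ⊆ ⋃ ab ∈ (Finset.univ : Finset (Fin p × Fin p)),
        {ω | t ≤ |sampleCov (fun i => Y i ω) ab.1 ab.2 - A ab.1 ab.2|} := by
    intro ω hω
    simp only [Set.mem_compl_iff, Set.mem_ofPred_eq, not_forall, not_lt] at hω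
    obtain ⟨a, b, hab⟩ := hω
    simp only [Set.mem_iUnion]
    exact ⟨(a, b), Finset.mem_univ _, hab⟩
  calc _ ≤ P.real (⋃ ab ∈ (Finset.univ : Finset (Fin p × Fin p)),
        {ω | t ≤ |sampleCov (fun i => Y i ω) ab.1 ab.2 - A ab.1 ab.2|}) :=
        measureReal_mono hsub (measure_ne_top _ _)
    _ ≤ ∑ ab : Fin p × Fin p,
        P.real {ω | t ≤ |sampleCov (fun i => Y i ω) ab.1 ab.2 - A ab.1 ab.2|} :=
        measureReal_biUnion_finset_le _ _
    _ ≤ ∑ _ab : Fin p × Fin p, q := Finset.sum_le_sum fun ab _ => h ab.1 ab.2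
    _ = p ^ 2 * q := by simp [sq]

/-- Sets that contain sets of probability tending to one. -/
lemma tendsto_measure_one_of_compl_le {X : ℕ → Type*} [∀ n, MeasurableSpace (X n)]
    {P : ∀ n, Measure (X n)} [∀ n, IsProbabilityMeasure (P n)] {s g : ∀ n, Set (X n)} {r : ℕ → ℝ}
    (hr : Tendsto r atTop (𝓝 0)) (hgs : ∀ᶠ n in atTop, g n ⊆ s n)
    (hg : ∀ᶠ n in atTop, (P n).real (g n)ᶜ ≤ r n) :
    Tendsto (fun n => P n (s n)) atTop (𝓝 1) := by
  have hlow : Tendsto (fun n => 1 - ENNReal.ofReal (r n)) atTop (𝓝 1) := by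
    have h1 := ENNReal.Tendsto.sub (tendsto_const_nhds (x := (1 : ENNReal)) (f := atTop))
      (ENNReal.tendsto_ofReal hr) (Or.inl ENNReal.one_ne_top)
    simpa using h1
  refine tendsto_of_tendsto_of_tendsto_of_le_of_le' hlow tendsto_const_nhds ?_
    (Eventually.of_forall fun n => prob_le_one)
  filter_upwards [hgs, hg] with n h1 h2
  rw [tsub_le_iff_right]
  -- Only monotonicity and subadditivity are used, so no measurability of the two sets is required.
  calc (1 : ENNReal) = P n Set.univ := measure_univ.symm
    _ ≤ P n (s n ∪ (g n)ᶜ) := by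
        apply measure_mono
        intro ω _
        by_cases h : ω ∈ g n
        · exact Or.inl (h1 h)
        · exact Or.inr h
    _ ≤ P n (s n) + P n (g n)ᶜ := measure_union_le _ _
    _ ≤ P n (s n) + ENNReal.ofReal (r n) := by
        gcongr
        rw [← ofReal_measureReal]
        exact ENNReal.ofReal_le_ofReal h2

/-! ### Assembling the deterministic and the probabilistic bounds -/

theorem lemma7
    (p : ℕ → ℕ) (hp3 : ∀ n, 3 ≤ p n) (hp : Tendsto p atTop atTop)
    -- the `p`-cycle with an RCM ordering
    (σ : ∀ n, Fin (p n) ≃ Fin (p n))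
    (hσ : ∀ n, IsRCMOrdering (SimpleGraph.cycleGraph (p n)) (σ n))
    (Gσ : ∀ n, SimpleGraph (Fin (p n)))
    (hGσ : ∀ n, Gσ n = orderedGraph (SimpleGraph.cycleGraph (p n)) (σ n))
    -- the true precision matrices and their Cholesky factors
    (Ωbar Lbar : ∀ n, Matrix (Fin (p n)) (Fin (p n)) ℝ)
    (hΩ : ∀ n, Ωbar n ∈ concentrationSet (Gσ n))
    (hL : ∀ n, IsCholeskyFactor (Lbar n) (Ωbar n))
    -- the observations
    {X : ℕ → Type*} [∀ n, MeasurableSpace (X n)]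
    (P : ∀ n, Measure (X n)) [∀ n, IsProbabilityMeasure (P n)]
    (Y : ∀ n, Fin n → X n → Fin (p n) → ℝ)
    (hY : ∀ n, IsIIDSample (P n) (Y n) (Ωbar n))
    -- A1
    (hA1 : ∃ δ : ℝ, 0 < δ ∧ ∀ n, ∀ t ∈ spectrum ℝ (Ωbar n), δ ≤ t ∧ t ≤ δ⁻¹)
    -- A2
    (hA2 : ∃ c : ℝ, 0 < c ∧ ∀ n (i : Fin n) (x : Fin (p n) → ℝ),
      Integrable (fun ω => Real.exp (x ⬝ᵥ Y n i ω)) (P n) ∧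
      ∫ ω, Real.exp (x ⬝ᵥ Y n i ω) ∂(P n) ≤ Real.exp (c * (x ⬝ᵥ x)))
    -- A3', first part (rows `3 ≤ j ≤ p - 1`, which are `2 ≤ j ≤ p - 2` when counted from `0`)
    (hA3ratio : ∃ ξ : ℝ, ξ < 1 ∧ ∀ n (i j : Fin (p n)), (i : ℕ) + 2 = j → (j : ℕ) + 1 < p n →
      |Lbar n j i| / Lbar n j j ≤ ξ)
    -- A3', second part
    (hA3rate : Tendsto (fun n : ℕ => ((Gσ n).edgeSet.ncard : ℝ) * Real.log (p n) / n)
      atTop (𝓝 0)) :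
    ∃ K K' : ℝ,
      Tendsto (fun n : ℕ => P n {ω |
          ‖ccaL (Gσ n) (sampleCov fun i => Y n i ω) - Lbar n‖
            ≤ K * √((((Gσ n).edgeSet.ncard : ℝ) + 1) * Real.log (p n) / n) ∧
          ‖ccaOmega (Gσ n) (sampleCov fun i => Y n i ω) - Ωbar n‖
            ≤ K' * √((((Gσ n).edgeSet.ncard : ℝ) + 1) * Real.log (p n) / n)})
        atTop (𝓝 1) := by
  obtain ⟨δ, hδ, hspec⟩ := hA1
  obtain ⟨c, hc, hA2⟩ := hA2
  obtain ⟨ξ, hξ, hratio⟩ := hA3ratio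
  obtain ⟨C, t₀, hC, ht₀, htail⟩ := exists_sampleCov_tail hc
  obtain ⟨D, ε₀, hD, hε₀, hcca⟩ := exists_ccaL_bound hδ hξ
  -- With this `κ` the tail exponent `n t² / (4C)` equals `3 log p`; each entry fails with
  -- probability at most `2 p⁻³`, and the union over `p²` entries leaves `2 / p`.
  set κ : ℝ := √(12 * C) with hκ
  have hκ0 : 0 < κ := Real.sqrt_pos.mpr (by positivity)
  set t : ℕ → ℝ := fun n => κ * √(Real.log (p n) / n) with ht
  have ht0 : ∀ n, 0 ≤ t n := fun n => by positivity
  have hpR : ∀ n, (3 : ℝ) ≤ p n := fun n => by exact_mod_cast hp3 n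
  have hlog : ∀ n, 0 ≤ Real.log (p n) := fun n => Real.log_nonneg (by linarith [hpR n])
  have hcard : ∀ n, (p n : ℝ) ≤ (Gσ n).edgeSet.ncard + 1 := by
    intro n
    rw [hGσ n]
    exact_mod_cast (hσ n).le_ncard_edgeSet
  have hband : ∀ n i j, (Gσ n).Adj i j → (i : ℕ) ≤ j + 2 := by
    intro n i j h
    rw [hGσ n] at h
    exact (hσ n).adj_le_add_two h
  have hrate : Tendsto (fun n : ℕ => Real.log (p n) / n) atTop (𝓝 0) := by
    refine squeeze_zero (fun n => div_nonneg (hlog n) (Nat.cast_nonneg n)) (fun n => ?_) hA3rate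
    have h1 : (1 : ℝ) ≤ (Gσ n).edgeSet.ncard := by linarith [hcard n, hpR n]
    gcongr
    exact le_mul_of_one_le_left (hlog n) h1
  have htlim : Tendsto t atTop (𝓝 0) := by
    have h1 := (hrate.sqrt).const_mul κ
    simpa [ht] using h1
  have hsmall : ∀ r : ℝ, 0 < r → ∀ᶠ n in atTop, t n ≤ r := fun r hr =>
    (htlim.eventually (gt_mem_nhds hr)).mono fun n hn => hn.le
  -- Both constants carry `√5` from the five diagonals. In the second, `D * ε₀` caps the quadratic
  -- part of the error of `L Lᵀ`, valid once `t n ≤ ε₀`.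
  refine ⟨√5 * (D * κ), √5 * (3 * (D * κ * (D * ε₀ + 2 * √δ⁻¹))), ?_⟩
  refine tendsto_measure_one_of_compl_le (P := P) (r := fun n => 2 * ((p n : ℝ))⁻¹)
    (g := fun n => {ω | ∀ a b, |sampleCov (fun i => Y n i ω) a b - (Ωbar n)⁻¹ a b| < t n})
    ?_ ?_ ?_
  · have h1 := (tendsto_natCast_atTop_atTop (R := ℝ)).comp hp
    simpa using (tendsto_inv_atTop_zero.comp h1).const_mul 2
  · filter_upwards [hsmall ε₀ hε₀] with n hn ω hω
    have hω' : ∀ a b, |sampleCov (fun i => Y n i ω) a b - (Ωbar n)⁻¹ a b| ≤ t n :=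
      fun a b => (hω a b).le
    obtain ⟨h1, h2, h3, h4⟩ := hcca (p n) (Gσ n) (Lbar n) (Ωbar n) _ (t n) (hband n) (hΩ n)
      (hspec n) (hL n) (hratio n) (ht0 n) hn hω'
    set F := ccaL (Gσ n) (sampleCov fun i => Y n i ω) with hF
    have hDt : 0 ≤ D * t n := mul_nonneg hD.le (ht0 n)
    -- The factor `√p` of the banded Frobenius norm is absorbed here through `p ≤ |E| + 1`.
    have hsqrt : ∀ r : ℝ, 0 ≤ r → √(5 * p n) * (r * √(Real.log (p n) / n))
        ≤ √5 * r * √((((Gσ n).edgeSet.ncard : ℝ) + 1) * Real.log (p n) / n) := by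
      intro r hr
      rw [mul_div_assoc (((Gσ n).edgeSet.ncard : ℝ) + 1), Real.sqrt_mul (by norm_num),
        Real.sqrt_mul (by positivity)]
      calc √5 * √(p n) * (r * √(Real.log (p n) / n))
          = √5 * r * (√(p n) * √(Real.log (p n) / n)) := by ring
        _ ≤ _ := by
            gcongr
            exact hcard n
    constructor
    · refine (frobenius_norm_le_of_band hDt h1 (h2.band_sub h3)).trans ?_
      have h5 : D * t n = D * κ * √(Real.log (p n) / n) := by rw [ht]; ring
      rw [h5]
      exact hsqrt _ (by positivity)
    · have hΩeq : ccaOmega (Gσ n) (sampleCov fun i => Y n i ω) - Ωbar n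
          = F * Fᵀ - Lbar n * (Lbar n)ᵀ := by
        rw [ccaOmega, ← hF, ← (hL n).eq]
      rw [hΩeq]
      have hent : ∀ i j, |(F * Fᵀ - Lbar n * (Lbar n)ᵀ) i j|
          ≤ 3 * (D * κ * (D * ε₀ + 2 * √δ⁻¹)) * √(Real.log (p n) / n) := by
        intro i j
        refine (h2.abs_mul_transpose_sub_le h3 hDt (Real.sqrt_nonneg _) h4 h1 i j).trans ?_
        calc 3 * (D * t n * (D * t n + 2 * √δ⁻¹))
            ≤ 3 * (D * t n * (D * ε₀ + 2 * √δ⁻¹)) := by gcongr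
          _ = _ := by rw [ht]; ring
      refine (frobenius_norm_le_of_band (by positivity) hent fun i j hne => ?_).trans
        (hsqrt _ (by positivity))
      by_contra hnot
      refine hne ?_
      have h5 : (F * Fᵀ) i j = 0 := by
        by_contra h; exact hnot (h2.mul_transpose_band i j h)
      have h6 : (Lbar n * (Lbar n)ᵀ) i j = 0 := by
        by_contra h; exact hnot (h3.mul_transpose_band i j h)
      rw [Matrix.sub_apply, h5, h6, sub_zero]
  · filter_upwards [hsmall t₀ ht₀, eventually_gt_atTop 0] with n hn hn0
    have h1 := htail (P n) (Y n) (Ωbar n) (hY n) hn0 (hA2 n)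
    refine (measureReal_compl_sampleCov_close_le fun a b => h1 a b (t n) (ht0 n) hn).trans
      (le_of_eq ?_)
    have hnR : (0 : ℝ) < n := by exact_mod_cast hn0
    have hp0 : (0 : ℝ) < p n := by linarith [hpR n]
    have h2 : -(n * t n ^ 2 / (4 * C)) = -Real.log ((p n : ℝ) ^ 3) := by
      rw [ht, Real.log_pow]
      simp only
      rw [mul_pow, hκ, Real.sq_sqrt (by positivity),
        Real.sq_sqrt (div_nonneg (hlog n) hnR.le)]
      push_cast
      field_simp
      ring
    rw [h2, Real.exp_neg, Real.exp_log (by positivity)]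
    field_simp
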